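/- Let $n\ge 1$ and let $\mathbb H$ be the quaternions. Write $q=(q_1,q')\in\mathbb H^n$ with $q'=(q_2,\dots,q_n)$, and $\mathbf e=(1,0,\dots,0)$. Let $$\mathcal U_n=\{q\in\mathbb H^n:\ \operatorname{Re}q_1>|q'|^2\},\qquad \partial\mathcal U_n=\{q\in\mathbb H^n:\ \operatorname{Re}q_1=|q'|^2\},$$ and let $\beta$ be the measure on $\partial\mathcal U_n$ obtained by pulling back Lebesgue measure on $\operatorname{Im}\mathbb H\times\mathbb H^{n-1}\cong\mathbb R^3\times\mathbb R^{4(n-1)}$ under the bijection $(q_1,q')\mapsto(\operatorname{Im}q_1,q')$. Let $L^2(\partial\mathcal U_n)$ be the space of $\mathbb H$-valued functions square integrable with respect to $\beta$ (modulo equality $\beta$-almost everywhere), a right $\mathbb H$-vector space under pointwise multiplication on the right. A $C^1$ function $F:\mathcal U_n\to\mathbb H$ is regular if, with $q_l=x_{4l-3}+x_{4l-2}\mathbf i+x_{4l-1}\mathbf j+x_{4l}\mathbf k$, $$(\partial_{x_{4l-3}}+\mathbf i\,\partial_{x_{4l-2}}+\mathbf j\,\partial_{x_{4l-1}}+\mathbf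 k\,\partial_{x_{4l}})F=0\quad\text{on }\mathcal U_n,\qquad l=1,\dots,n.$$ The Hardy space $H^2(\mathcal U_n)$ consists of all regular $F$ on $\mathcal U_n$ with $$\|F\|_{H^2(\mathcal U_n)}^2:=\sup_{\varepsilon>0}\int_{\partial\mathcal U_n}|F(q+\varepsilon\mathbf e)|^2\,d\beta(q)<\infty .$$ Theorem. 1. For every $F\in H^2(\mathcal U_n)$ there exists a (necessarily unique) $F^b\in L^2(\partial\mathcal U_n)$, the boundary value of $F$, such that the functions $q\mapsto F(q+\varepsilon\mathbf e)$ on $\partial\mathcal U_n$ belong to $L^2(\partial\mathcal U_n)$ and converge to $F^b$ in the $L^2(\partial\mathcal U_n)$ norm as $\varepsilon\to0^+$. 2. $\|F^b\|_{L^2(\partial\mathcal U_n)}=\|F\|_{H^2(\mathcal U_n)}$ for every $F\in H^2(\mathcal U_n)$. 3. The set $\{F^b: F\in H^2(\mathcal U_n)\}$ of all boundary values is a closed right $\mathbb H$-linear subspace of $L^2(\partial\mathcal U_n)$. -/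

import Mathlib

open MeasureTheory Filter Topology
open scoped Quaternion ENNReal

noncomputable section

namespace QuaternionicSiegel

/-- The quaternion `a + b i + c j + d k`. -/
def quat (a b c d : ℝ) : ℍ[ℝ] := ⟨a, b, c, d⟩

@[simp] theorem quat_re (a b c d : ℝ) : (quat a b c d).re = a := rfl
@[simp] theorem quat_imI (a b c d : ℝ) : (quat a b c d).imI = b := rfl
@[simp] theorem quat_imJ (a b c d : ℝ) : (quat a b c d).imJ = c := rfl
@[simp] theorem quat_imK (a b c d : ℝ) : (quat a b c d).imK = d := rfl

theorem quat_eta (q : ℍ[ℝ]) : quat q.re q.imI q.imJ q.imK = q := rfl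

theorem continuous_quat {X : Type*} [TopologicalSpace X] {a b c d : X → ℝ} (ha : Continuous a)
    (hb : Continuous b) (hc : Continuous c) (hd : Continuous d) :
    Continuous fun x => quat (a x) (b x) (c x) (d x) := by
  have h := Quaternion.linearIsometryEquivTuple.symm.continuous.comp
    ((PiLp.continuous_toLp 2 (fun _ : Fin 4 => ℝ)).comp
      (continuous_pi (f := fun x => ![a x, b x, c x, d x]) (fun i => by
        fin_cases i <;> assumption)))
  exact h

/-- The quaternionic space `ℍⁿ` with `n = m + 1`.  A point is `q = (q₁, q')`, where `q₁ = q 0` and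
`q' = (q 1, …, q m) ∈ ℍⁿ⁻¹`. -/
abbrev HSpace (m : ℕ) : Type := Fin (m + 1) → ℍ[ℝ]

/-- `|q'|²`, the sum of the squared norms of all the coordinates but the first. -/
def tailNormSq {m : ℕ} (q : HSpace m) : ℝ := ∑ l : Fin m, ‖q l.succ‖ ^ 2

/-- The quaternionic Siegel upper half space `{q | Re q₁ > |q'|²}`. -/
def siegelHalfSpace (m : ℕ) : Set (HSpace m) := {q | (q 0).re > tailNormSq q}

/-- Its boundary, the quadratic hypersurface `{q | Re q₁ = |q'|²}`. -/
def siegelBoundary (m : ℕ) : Set (HSpace m) := {q | (q 0).re = tailNormSq q}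

/-- The Cauchy–Fueter operator in the `l`-th quaternionic variable (acting from the left),
`∂̄_{q_l} F = ∂_{x} F + i ∂_{y} F + j ∂_{z} F + k ∂_{w} F` for `q_l = x + y i + z j + w k`. -/
def cauchyFueter {m : ℕ} (l : Fin (m + 1)) (F : HSpace m → ℍ[ℝ]) (q : HSpace m) : ℍ[ℝ] :=
  fderiv ℝ F q (Pi.single l 1)
    + quat 0 1 0 0 * fderiv ℝ F q (Pi.single l (quat 0 1 0 0))
    + quat 0 0 1 0 * fderiv ℝ F q (Pi.single l (quat 0 0 1 0))
    + quat 0 0 0 1 * fderiv ℝ F q (Pi.single l (quat 0 0 0 1))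

/-- `F` is (left) regular on `D` (used for open `D`): it is `C¹` there and satisfies the
Cauchy–Fueter equations in each variable. -/
def IsRegularOn {m : ℕ} (F : HSpace m → ℍ[ℝ]) (D : Set (HSpace m)) : Prop :=
  ContDiffOn ℝ 1 F D ∧ ∀ q ∈ D, ∀ l, cauchyFueter l F q = 0

/-- The underlying space `ℝ³ × ℝ⁴⁽ⁿ⁻¹⁾` of the quaternionic Heisenberg group, in real coordinates
of `Im ℍ × ℍⁿ⁻¹`.  Its Haar measure is the Lebesgue measure `volume`. -/
abbrev Heisenberg (m : ℕ) : Type := (Fin 3 → ℝ) × (Fin m → Fin 4 → ℝ)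

/-- The projection `(|q'|² + x₂ i + x₃ j + x₄ k, q') ↦ (x₂ i + x₃ j + x₄ k, q')`, which
identifies the boundary with the quaternionic Heisenberg group. -/
def boundaryProjection (m : ℕ) : siegelBoundary m ≃ₜ Heisenberg m where
  toFun q := (![(q.1 0).imI, (q.1 0).imJ, (q.1 0).imK],
    fun l => ![(q.1 l.succ).re, (q.1 l.succ).imI, (q.1 l.succ).imJ, (q.1 l.succ).imK])
  invFun p := ⟨Fin.cons
      (quat (∑ l, ‖quat (p.2 l 0) (p.2 l 1) (p.2 l 2) (p.2 l 3)‖ ^ 2) (p.1 0) (p.1 1) (p.1 2))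
      (fun l => quat (p.2 l 0) (p.2 l 1) (p.2 l 2) (p.2 l 3)), by
    simp [siegelBoundary, tailNormSq]⟩
  left_inv := by
    rintro ⟨q, hq⟩
    apply Subtype.ext
    funext l
    refine Fin.cases ?_ (fun i => ?_) l
    · have h : (q 0).re = ∑ l : Fin m, ‖q l.succ‖ ^ 2 := hq
      simp [quat_eta, ← h]
    · simp [quat_eta]
  right_inv := by
    rintro ⟨v, y⟩
    refine Prod.ext ?_ ?_
    · funext i
      fin_cases i <;> simp
    · funext l i
      fin_cases i <;> simp
  continuous_toFun := by
    refine Continuous.prodMk ?_ ?_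
    · refine continuous_pi fun i => ?_
      fin_cases i
      · exact Quaternion.continuous_imI.comp ((continuous_apply 0).comp continuous_subtype_val)
      · exact Quaternion.continuous_imJ.comp ((continuous_apply 0).comp continuous_subtype_val)
      · exact Quaternion.continuous_imK.comp ((continuous_apply 0).comp continuous_subtype_val)
    · refine continuous_pi fun l => continuous_pi fun i => ?_
      have h : Continuous fun q : siegelBoundary m => q.1 l.succ :=
        (continuous_apply l.succ).comp continuous_subtype_val
      fin_cases i
      · exact Quaternion.continuous_re.comp h
      · exact Quaternion.continuous_imI.comp h
      · exact Quaternion.continuous_imJ.comp h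
      · exact Quaternion.continuous_imK.comp h
  continuous_invFun := by
    have hl : ∀ l : Fin m, Continuous fun p : Heisenberg m =>
        quat (p.2 l 0) (p.2 l 1) (p.2 l 2) (p.2 l 3) := fun l =>
      continuous_quat (by fun_prop) (by fun_prop) (by fun_prop) (by fun_prop)
    refine Continuous.subtype_mk (continuous_pi fun l => ?_) _
    refine Fin.cases ?_ (fun i => ?_) l
    · exact continuous_quat (continuous_finsetSum _ fun l _ => (hl l).norm.pow 2)
        (by fun_prop) (by fun_prop) (by fun_prop)
    · exact hl i

instance (m : ℕ) : MeasurableSpace (siegelBoundary m) := borel _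

instance (m : ℕ) : BorelSpace (siegelBoundary m) := ⟨rfl⟩

/-- The measure `dβ` on the boundary: Lebesgue measure on `ℝ³ × ℝ⁴⁽ⁿ⁻¹⁾`, transported by the
projection. -/
def boundaryMeasure (m : ℕ) : Measure (siegelBoundary m) :=
  (volume : Measure (Heisenberg m)).map (boundaryProjection m).symm

/-- The space `L²(∂𝒰ₙ)` of `ℍ`-valued functions square integrable for `dβ`. -/
abbrev BoundaryL2 (m : ℕ) : Type := Lp ℍ[ℝ] 2 (boundaryMeasure m)

/-- The restriction to the boundary of the vertical translate `q ↦ F (q + ε e)`,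
`e = (1, 0, …, 0)`. -/
def verticalTranslate {m : ℕ} (F : HSpace m → ℍ[ℝ]) (ε : ℝ) (q : siegelBoundary m) : ℍ[ℝ] :=
  F (q.1 + Pi.single 0 (ε : ℍ[ℝ]))

/-- `sup_{ε > 0} ∫ |F(q + ε e)|² dβ(q)`. -/
def hardySup {m : ℕ} (F : HSpace m → ℍ[ℝ]) : ℝ≥0∞ :=
  ⨆ (ε : ℝ) (_ : 0 < ε), ∫⁻ q, ‖verticalTranslate F ε q‖ₑ ^ 2 ∂(boundaryMeasure m)

/-- `F` belongs to the Hardy space `H²(𝒰ₙ)` (only the values of `F` on `𝒰ₙ` matter). -/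
def MemHardy {m : ℕ} (F : HSpace m → ℍ[ℝ]) : Prop :=
  IsRegularOn F (siegelHalfSpace m) ∧ hardySup F < ∞

/-- The norm of `H²(𝒰ₙ)`. -/
def hardyNorm {m : ℕ} (F : HSpace m → ℍ[ℝ]) : ℝ := √(hardySup F).toReal

/-- `f` is the boundary value of `F`: the vertical translates of `F` lie in `L²(∂𝒰ₙ)` and converge
to `f` in the `L²` norm as `ε → 0⁺`. -/
def HasBoundaryValue {m : ℕ} (F : HSpace m → ℍ[ℝ]) (f : BoundaryL2 m) : Prop :=
  (∀ ε > 0, MemLp (verticalTranslate F ε) 2 (boundaryMeasure m)) ∧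
    Tendsto (fun ε : ℝ => eLpNorm (verticalTranslate F ε - ⇑f) 2 (boundaryMeasure m))
      (𝓝[>] 0) (𝓝 0)

end QuaternionicSiegel

end

/-! Boundary values rest on the Cauchy–Fueter equation in the first variable alone. Write u(t) for
the slice of F at height t, a function on the Heisenberg group. The equation says u' = -Du with D =
Σ e_j ∂_j over the three central directions. Left multiplication by e_j and the derivative ∂_j are
both skew, so D is formally symmetric and ⟨u(t), u(s - t)⟩ does not depend on t. Slowly varying
cutoffs make this rigorous (`MemHardy.abs_cutoff_pairing_sub_le`, `MemHardy.pairing_eq`).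

Hence ⟨u(a), u(b)⟩ = ψ(a + b), and expanding ‖u(a) - u(b)‖² ≥ 0 shows that ψ is midpoint convex.
Being bounded, ψ is nonincreasing. It therefore has a limit at 0⁺, which forces u to be Cauchy
there, and the norm of its limit is the supremum of the slice norms (`exists_tendsto_of_inner_eq`).
This gives existence and the norm identity.

For closedness, the norm identity turns a Cauchy sequence of boundary values into a Cauchy sequence
in the Hardy norm, and interior estimates (`exists_local_bound`) make the functions and their first
derivatives converge locally uniformly. These estimates come from a mean value formula with a smooth
radial weight (`IsRegularOn.mean_value`), proved by a single integration by parts because F is only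
C¹. Fatou's lemma on each slice then controls the limit function. -/

namespace QuaternionicSiegel

/-! ### Convexity and curves in a Hilbert space -/

/-- A midpoint convex function on `(0, ∞)` that is bounded above is nonincreasing. -/
theorem le_of_midpoint_convex_of_bdd {ψ : ℝ → ℝ} {M : ℝ} (hM : ∀ t > 0, ψ t ≤ M)
    (hmid : ∀ x > 0, ∀ y > 0, 2 * ψ ((x + y) / 2) ≤ ψ x + ψ y) {a b : ℝ} (ha : 0 < a)
    (hab : a ≤ b) : ψ b ≤ ψ a := by
  by_contra! hlt
  set d := b - a with hd
  have hd0 : 0 ≤ d := by linarith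
  have hpos : ∀ k : ℕ, 0 < a + k * d := fun k => by positivity
  -- Midpoint convexity makes the increments over steps of length d nondecreasing, so each is at
  -- least the first one. If that is positive, ψ grows at least linearly and exceeds M.
  have hstep : ∀ k : ℕ, ψ b - ψ a ≤ ψ (a + (k + 1 : ℕ) * d) - ψ (a + k * d) := by
    intro k
    induction k with
    | zero => simp [hd]
    | succ k ih =>
      have h := hmid _ (hpos k) _ (hpos (k + 2))
      have e : (a + (k : ℕ) * d + (a + ((k + 2 : ℕ) : ℝ) * d)) / 2 = a + (k + 1 : ℕ) * d := by
        push_cast; ring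
      rw [e] at h
      have e2 : k + 1 + 1 = k + 2 := rfl
      rw [e2]
      linarith
  have hk : ∀ k : ℕ, ψ a + k * (ψ b - ψ a) ≤ ψ (a + k * d) := by
    intro k
    induction k with
    | zero => simp
    | succ k ih =>
      have := hstep k
      push_cast at this ⊢
      linarith
  obtain ⟨k, hk'⟩ := exists_nat_gt ((M - ψ a) / (ψ b - ψ a))
  rw [div_lt_iff₀ (by linarith)] at hk'
  have := hk k
  have := hM _ (hpos k)
  linarith

/-- A bounded curve `u` in a Hilbert space such that `⟪u a, u b⟫` depends only on `a + b` has a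
limit at `0⁺`, whose norm dominates all the norms `‖u t‖`. -/
theorem exists_tendsto_of_inner_eq {H : Type*} [NormedAddCommGroup H] [InnerProductSpace ℝ H]
    [CompleteSpace H] {u : ℝ → H} {M : ℝ} (hM : ∀ t > 0, ‖u t‖ ^ 2 ≤ M)
    (hu : ∀ a > 0, ∀ b > 0, ∀ c > 0, ∀ d > 0, a + b = c + d →
      inner ℝ (u a) (u b) = inner ℝ (u c) (u d)) :
    ∃ f, Tendsto u (𝓝[>] 0) (𝓝 f) ∧ ∀ t > 0, ‖u t‖ ≤ ‖f‖ := by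
  -- The halved argument gives ⟨u a, u b⟩ = ψ (a + b).
  set ψ : ℝ → ℝ := fun t => ‖u (t / 2)‖ ^ 2 with hψ
  have hin : ∀ a > 0, ∀ b > 0, inner ℝ (u a) (u b) = ψ (a + b) := by
    intro a ha b hb
    rw [hψ]
    simp only
    rw [← real_inner_self_eq_norm_sq]
    exact hu a ha b hb _ (by linarith) _ (by linarith) (by ring)
  have hnorm : ∀ a, ‖u a‖ ^ 2 = ψ (2 * a) := by
    intro a
    simp [hψ]
  have hsub : ∀ a > 0, ∀ b > 0, ‖u a - u b‖ ^ 2 = ψ (2 * a) + ψ (2 * b) - 2 * ψ (a + b) := by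
    intro a ha b hb
    rw [norm_sub_sq_real, hin a ha b hb, hnorm, hnorm]
    ring
  have hψM : ∀ t > 0, ψ t ≤ M := fun t ht => hM _ (by linarith)
  have hanti : ∀ a b, 0 < a → a ≤ b → ψ b ≤ ψ a := by
    intro a b ha hab
    refine le_of_midpoint_convex_of_bdd hψM (fun x hx y hy => ?_) ha hab
    have h := hsub (x / 2) (by linarith) (y / 2) (by linarith)
    have e1 : 2 * (x / 2) = x := by ring
    have e2 : 2 * (y / 2) = y := by ring
    have e3 : x / 2 + y / 2 = (x + y) / 2 := by ring
    rw [e1, e2, e3] at h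
    nlinarith [sq_nonneg ‖u (x / 2) - u (y / 2)‖]
  have hbdd : BddAbove (ψ '' Set.Ioi 0) := ⟨M, by rintro _ ⟨t, ht, rfl⟩; exact hψM t ht⟩
  set L := sSup (ψ '' Set.Ioi 0) with hL
  have hle : ∀ t > 0, ψ t ≤ L := fun t ht => le_csSup hbdd ⟨t, ht, rfl⟩
  have hcauchy : Cauchy (map u (𝓝[>] 0)) := by
    rw [Metric.cauchy_iff]
    refine ⟨inferInstance, fun ε hε => ?_⟩
    -- With ψ t₀ > L - ε²/2 and a, b < t₀/2, monotonicity gives ‖u a - u b‖² ≤ 2L - 2ψ t₀ < ε².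
    obtain ⟨_, ⟨t₀, ht₀, rfl⟩, hlt⟩ := exists_lt_of_lt_csSup
      (s := ψ '' Set.Ioi 0) ⟨_, 1, by simp, rfl⟩ (b := L - ε ^ 2 / 2) (by rw [← hL]; nlinarith)
    have ht₀' : (0 : ℝ) < t₀ := ht₀
    refine ⟨u '' Set.Ioo 0 (t₀ / 2),
      image_mem_map (Ioo_mem_nhdsGT (by linarith)), ?_⟩
    rintro _ ⟨a, ha, rfl⟩ _ ⟨b, hb, rfl⟩
    rw [dist_eq_norm]
    refine lt_of_pow_lt_pow_left₀ 2 hε.le ?_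
    rw [hsub a ha.1 b hb.1]
    have h1 := hle (2 * a) (by linarith [ha.1])
    have h2 := hle (2 * b) (by linarith [hb.1])
    have h3 := hanti (a + b) t₀ (by linarith [ha.1, hb.1]) (by linarith [ha.2, hb.2])
    linarith
  obtain ⟨f, hf⟩ := CompleteSpace.complete hcauchy
  refine ⟨f, hf, fun t ht => ?_⟩
  refine ge_of_tendsto (Tendsto.norm hf) ?_
  filter_upwards [Ioo_mem_nhdsGT ht] with s hs
  refine (sq_le_sq₀ (norm_nonneg _) (norm_nonneg _)).1 ?_
  rw [hnorm, hnorm]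
  exact hanti _ _ (by linarith [hs.1]) (by linarith [hs.2])

/-! ### Differentiation and integration by parts -/

/-- Differentiation under the integral sign over a compact set. -/
theorem hasDerivAt_setIntegral_of_isCompact {X E : Type*} [TopologicalSpace X] [T2Space X]
    [MeasurableSpace X] [OpensMeasurableSpace X] {μ : Measure X} [IsFiniteMeasureOnCompacts μ]
    [NormedAddCommGroup E] [NormedSpace ℝ E] {f f' : ℝ → X → E} {K : Set X}
    (hK : IsCompact K) {s : Set ℝ} (hs : IsOpen s)
    (hf : ContinuousOn (fun p : ℝ × X => f p.1 p.2) (s ×ˢ K))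
    (hf' : ContinuousOn (fun p : ℝ × X => f' p.1 p.2) (s ×ˢ K))
    (hd : ∀ t ∈ s, ∀ x ∈ K, HasDerivAt (f · x) (f' t x) t) {t₀ : ℝ} (ht₀ : t₀ ∈ s) :
    HasDerivAt (fun t => ∫ x in K, f t x ∂μ) (∫ x in K, f' t₀ x ∂μ) t₀ := by
  obtain ⟨ε, hε, hεs⟩ := Metric.nhds_basis_closedBall.mem_iff.1 (hs.mem_nhds ht₀)
  have hslice : ∀ {g : ℝ → X → E}, ContinuousOn (fun p : ℝ × X => g p.1 p.2) (s ×ˢ K) →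
      ∀ t ∈ s, ContinuousOn (g t) K := by
    intro g hg t ht
    exact hg.comp (f := fun x => (t, x)) (by fun_prop) (fun x hx => ⟨ht, hx⟩)
  obtain ⟨C, hC⟩ := ((isCompact_closedBall t₀ ε).prod hK).exists_bound_of_continuousOn
    (hf'.mono (Set.prod_mono_left hεs))
  refine (hasDerivAt_integral_of_dominated_loc_of_deriv_le (bound := fun _ => C)
    (Metric.closedBall_mem_nhds t₀ hε) ?_ ?_ ?_ ?_ ?_ ?_).2
  · filter_upwards [hs.mem_nhds ht₀] with t ht
    exact (hslice hf t ht).aestronglyMeasurable_of_isCompact hK hK.measurableSet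
  · exact (hslice hf t₀ ht₀).integrableOn_compact hK
  · exact (hslice hf' t₀ ht₀).aestronglyMeasurable_of_isCompact hK hK.measurableSet
  · filter_upwards [ae_restrict_mem hK.measurableSet] with x hx t ht
    exact hC (t, x) ⟨ht, hx⟩
  · exact integrableOn_const hK.measure_lt_top.ne
  · filter_upwards [ae_restrict_mem hK.measurableSet] with x hx t ht
    exact hd t (hεs ht) x hx

/-- The integral of a directional derivative vanishes. -/
theorem integral_eq_zero_of_hasLineDerivAt {V E : Type*} [NormedAddCommGroup V] [NormedSpace ℝ V]
    [FiniteDimensional ℝ V] [MeasurableSpace V] [BorelSpace V] {μ : Measure V}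
    [μ.IsAddHaarMeasure] [NormedAddCommGroup E] [NormedSpace ℝ E] {g g' : V → E} {v : V}
    (hg : Integrable g μ) (hg' : Integrable g' μ) (hd : ∀ x, HasLineDerivAt ℝ g (g' x) x v) :
    ∫ x, g' x ∂μ = 0 := by
  -- Integration by parts against the constant 1, whose derivative is 0.
  have h := integral_bilinear_hasLineDerivAt_right_eq_neg_left_of_integrable (μ := μ)
    (f := fun _ : V => (1 : ℝ)) (f' := fun _ => 0) (g := g) (g' := g') (v := v)
    (B := ContinuousLinearMap.lsmul ℝ ℝ) (by simp) (by simpa using hg')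
    (by simpa using hg)
    (fun x _ => by
      rw [HasLineDerivAt]
      exact hasDerivAt_const _ _)
    (fun x _ => hd x)
  simpa using h

/-! ### Slices in Heisenberg coordinates -/

noncomputable section

variable {m : ℕ}

instance instIsAddHaarMeasureHeisenberg :
    (volume : Measure (Heisenberg m)).IsAddHaarMeasure := by
  have h4 : (volume : Measure (Fin 4 → ℝ)).IsAddHaarMeasure := inferInstance
  have h : (volume : Measure (Fin m → Fin 4 → ℝ)).IsAddHaarMeasure :=
    Measure.pi.isAddHaarMeasure (fun _ : Fin m => (volume : Measure (Fin 4 → ℝ)))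
  exact Measure.prod.instIsAddHaarMeasure (volume : Measure (Fin 3 → ℝ))
    (volume : Measure (Fin m → Fin 4 → ℝ))

/-- The point of `𝒰ₙ` at height `t` above the boundary point with Heisenberg coordinates `p`. -/
def slicePoint (t : ℝ) (p : Heisenberg m) : HSpace m :=
  ((boundaryProjection m).symm p).1 + Pi.single 0 (t : ℍ[ℝ])

/-- The imaginary units `i, j, k`. -/
def imUnit : Fin 3 → ℍ[ℝ] := ![quat 0 1 0 0, quat 0 0 1 0, quat 0 0 0 1]

/-- The coordinate directions of the centre of the Heisenberg group. -/
def centreDir (j : Fin 3) : Heisenberg m := (Pi.single j 1, 0)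

theorem isOpen_siegelHalfSpace : IsOpen (siegelHalfSpace m) := by
  refine isOpen_lt ?_ (Quaternion.continuous_re.comp (continuous_apply 0))
  exact continuous_finsetSum _ fun l _ => ((continuous_apply l.succ).norm.pow 2)

theorem tailNormSq_add_single (q : HSpace m) (a : ℍ[ℝ]) :
    tailNormSq (q + Pi.single 0 a) = tailNormSq q := by
  simp [tailNormSq]

theorem slicePoint_mem {t : ℝ} (ht : 0 < t) (p : Heisenberg m) :
    slicePoint t p ∈ siegelHalfSpace m := by
  have h : (((boundaryProjection m).symm p).1 0).re
      = tailNormSq ((boundaryProjection m).symm p).1 := ((boundaryProjection m).symm p).2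
  simp only [siegelHalfSpace, slicePoint, Set.mem_ofPred_eq, tailNormSq_add_single, Pi.add_apply,
    Pi.single_eq_same, Quaternion.re_add, Quaternion.re_coe, h]
  linarith

theorem continuous_slicePoint : Continuous fun x : ℝ × Heisenberg m => slicePoint x.1 x.2 := by
  refine Continuous.add (continuous_subtype_val.comp
    ((boundaryProjection m).symm.continuous.comp continuous_snd)) ?_
  exact (continuous_single (A := fun _ : Fin (m + 1) => ℍ[ℝ]) 0).comp
    (Quaternion.continuous_coe.comp continuous_fst)

theorem slicePoint_add (t τ : ℝ) (p : Heisenberg m) :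
    slicePoint (t + τ) p = slicePoint t p + τ • (Pi.single 0 1 : HSpace m) := by
  rw [slicePoint, slicePoint, add_assoc]
  congr 1
  ext l : 1
  refine Fin.cases ?_ (fun i => ?_) l <;> simp [Quaternion.coe_add, ← Quaternion.coe_mul_eq_smul]

/-- The term |q'|² does not involve the central coordinates, so moving along the centre of the group
is a straight translation of ℍⁿ in the first variable. Central derivatives of a slice are thus
derivatives of F itself. -/
theorem slicePoint_add_centreDir (t τ : ℝ) (p : Heisenberg m) (j : Fin 3) :
    slicePoint t (p + τ • centreDir j) = slicePoint t p + τ • (Pi.single 0 (imUnit j) : HSpace m) := by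
  ext l : 1
  refine Fin.cases ?_ (fun i => ?_) l
  · ext <;> fin_cases j <;> simp [slicePoint, boundaryProjection, centreDir, imUnit]
  · simp [slicePoint, boundaryProjection, centreDir, imUnit]

theorem lintegral_boundaryMeasure (g : siegelBoundary m → ℝ≥0∞) :
    ∫⁻ q, g q ∂(boundaryMeasure m) = ∫⁻ p, g ((boundaryProjection m).symm p) :=
  (boundaryProjection m).symm.measurableEmbedding.lintegral_map g

theorem integral_boundaryMeasure {E : Type*} [NormedAddCommGroup E] [NormedSpace ℝ E]
    (g : siegelBoundary m → E) :
    ∫ q, g q ∂(boundaryMeasure m) = ∫ p, g ((boundaryProjection m).symm p) :=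
  (boundaryProjection m).symm.measurableEmbedding.integral_map g

section Regular

variable {F : HSpace m → ℍ[ℝ]}

theorem IsRegularOn.hasFDerivAt (hF : IsRegularOn F (siegelHalfSpace m)) {q : HSpace m}
    (hq : q ∈ siegelHalfSpace m) : HasFDerivAt F (fderiv ℝ F q) q :=
  ((hF.1.differentiableOn one_ne_zero).differentiableAt
    (isOpen_siegelHalfSpace.mem_nhds hq)).hasFDerivAt

theorem continuous_comp_slicePoint {E : Type*} [TopologicalSpace E] {g : HSpace m → E}
    (hg : ContinuousOn g (siegelHalfSpace m)) {X : Type*} [TopologicalSpace X] {t : X → ℝ}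
    {p : X → Heisenberg m} (ht : Continuous t) (hp : Continuous p) (hpos : ∀ x, 0 < t x) :
    Continuous fun x => g (slicePoint (t x) (p x)) := by
  have h1 : Continuous fun x => slicePoint (t x) (p x) := by
    have h0 : Continuous fun x => (t x, p x) := ht.prodMk hp
    have h1 := continuous_slicePoint (m := m)
    have h3 := Continuous.comp h1 h0
    exact h3
  have h2 : ∀ x, slicePoint (t x) (p x) ∈ siegelHalfSpace m :=
    fun x => slicePoint_mem (hpos x) (p x)
  exact hg.comp_continuous h1 h2

theorem continuous_verticalTranslate (hF : ContinuousOn F (siegelHalfSpace m)) {t : ℝ}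
    (ht : 0 < t) : Continuous (verticalTranslate F t) := by
  have h : Continuous fun p : Heisenberg m => F (slicePoint t p) :=
    continuous_comp_slicePoint hF continuous_const continuous_id fun _ => ht
  have e : verticalTranslate F t = (fun p => F (slicePoint t p)) ∘ boundaryProjection m := by
    ext1 q
    simp [verticalTranslate, slicePoint]
  rw [e]
  exact h.comp (boundaryProjection m).continuous

theorem lintegral_le_hardySup (F : HSpace m → ℍ[ℝ]) {t : ℝ} (ht : 0 < t) :
    ∫⁻ q, ‖verticalTranslate F t q‖ₑ ^ 2 ∂(boundaryMeasure m) ≤ hardySup F :=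
  le_iSup₂ (f := fun (ε : ℝ) (_ : 0 < ε) =>
    ∫⁻ q, ‖verticalTranslate F ε q‖ₑ ^ 2 ∂(boundaryMeasure m)) t ht

theorem MemHardy.memLp (hF : MemHardy F) {t : ℝ} (ht : 0 < t) :
    MemLp (verticalTranslate F t) 2 (boundaryMeasure m) := by
  refine ⟨(continuous_verticalTranslate hF.1.1.continuousOn ht).aestronglyMeasurable, ?_⟩
  rw [eLpNorm_lt_top_iff_lintegral_rpow_enorm_lt_top two_ne_zero ENNReal.ofNat_ne_top]
  simpa using (lintegral_le_hardySup F ht).trans_lt hF.2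

end Regular

end

/-! ### Invariance of the pairing of two slices -/

noncomputable section

variable {m : ℕ} {F : HSpace m → ℍ[ℝ]}

/-- This skewness, together with that of ∂_j, makes Σ e_j ∂_j formally symmetric. -/
theorem inner_imUnit_mul_left (j : Fin 3) (a b : ℍ[ℝ]) :
    inner ℝ (imUnit j * a) b = -inner ℝ a (imUnit j * b) := by
  simp only [Quaternion.inner_def]
  fin_cases j <;> simp [imUnit] <;> ring

theorem norm_imUnit (j : Fin 3) : ‖imUnit j‖ = 1 := by
  rw [← sq_eq_sq₀ (norm_nonneg _) zero_le_one, sq, ← Quaternion.normSq_eq_norm_mul_self]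
  fin_cases j <;> simp [imUnit, Quaternion.normSq_def']

theorem cauchyFueter_eq_sum (l : Fin (m + 1)) (F : HSpace m → ℍ[ℝ]) (q : HSpace m) :
    cauchyFueter l F q = fderiv ℝ F q (Pi.single l 1)
      + ∑ j, imUnit j * fderiv ℝ F q (Pi.single l (imUnit j)) := by
  simp [cauchyFueter, Fin.sum_univ_three, imUnit, add_assoc]

/-- The derivative of a function along the `j`-th imaginary direction of the first variable. -/
def imDeriv (F : HSpace m → ℍ[ℝ]) (j : Fin 3) (q : HSpace m) : ℍ[ℝ] :=
  fderiv ℝ F q (Pi.single 0 (imUnit j))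

theorem IsRegularOn.continuousOn_fderiv_apply (hF : IsRegularOn F (siegelHalfSpace m))
    (v : HSpace m) : ContinuousOn (fun q => fderiv ℝ F q v) (siegelHalfSpace m) :=
  (hF.1.continuousOn_fderiv_of_isOpen isOpen_siegelHalfSpace le_rfl).clm_apply continuousOn_const

/-- The Cauchy–Fueter equation in the first variable, solved for the real derivative, becomes an
evolution equation in the height. -/
theorem IsRegularOn.hasDerivAt_slicePoint (hF : IsRegularOn F (siegelHalfSpace m)) {t : ℝ}
    (ht : 0 < t) (p : Heisenberg m) :
    HasDerivAt (fun τ => F (slicePoint τ p))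
      (-∑ j, imUnit j * imDeriv F j (slicePoint t p)) t := by
  have hcf := hF.2 _ (slicePoint_mem ht p) 0
  rw [cauchyFueter_eq_sum] at hcf
  have h := (hF.hasFDerivAt (slicePoint_mem ht p)).hasLineDerivAt (Pi.single 0 1)
  rw [eq_neg_of_add_eq_zero_left hcf, HasLineDerivAt] at h
  have h2 := HasDerivAt.comp_sub_const (𝕜 := ℝ) t t (by simpa using h)
  refine h2.congr_of_eventuallyEq (Eventually.of_forall fun τ => ?_)
  simp only
  rw [← slicePoint_add]
  congr 2
  ring

theorem IsRegularOn.hasLineDerivAt_slicePoint (hF : IsRegularOn F (siegelHalfSpace m)) {t : ℝ}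
    (ht : 0 < t) (p : Heisenberg m) (j : Fin 3) :
    HasLineDerivAt ℝ (fun p => F (slicePoint t p)) (imDeriv F j (slicePoint t p)) p
      (centreDir j) := by
  have h := (hF.hasFDerivAt (slicePoint_mem ht p)).hasLineDerivAt (Pi.single 0 (imUnit j))
  rw [HasLineDerivAt] at h ⊢
  refine h.congr_of_eventuallyEq (Eventually.of_forall fun τ => ?_)
  simp only
  rw [slicePoint_add_centreDir]

theorem MemHardy.integrable_norm_sq (hF : MemHardy F) {t : ℝ} (ht : 0 < t) :
    Integrable (fun p => ‖F (slicePoint t p)‖ ^ 2) ∧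
      ∫ p, ‖F (slicePoint t p)‖ ^ 2 ≤ (hardySup F).toReal := by
  have hc : Continuous fun p : Heisenberg m => F (slicePoint t p) :=
    continuous_comp_slicePoint hF.1.1.continuousOn continuous_const continuous_id fun _ => ht
  have hle : ∫⁻ p, ‖F (slicePoint t p)‖ₑ ^ 2 ≤ hardySup F := by
    have := lintegral_le_hardySup F ht
    rwa [lintegral_boundaryMeasure] at this
  have he : ∀ p : Heisenberg m,
      ENNReal.ofReal (‖F (slicePoint t p)‖ ^ 2) = ‖F (slicePoint t p)‖ₑ ^ 2 := by
    intro p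
    rw [ENNReal.ofReal_pow (norm_nonneg _), ofReal_norm]
  have hnn : 0 ≤ᵐ[volume] fun p : Heisenberg m => ‖F (slicePoint t p)‖ ^ 2 :=
    Eventually.of_forall fun p => by positivity
  constructor
  · refine ⟨(hc.norm.pow 2).aestronglyMeasurable, ?_⟩
    rw [hasFiniteIntegral_iff_ofReal hnn]
    simp_rw [he]
    exact hle.trans_lt hF.2
  · rw [integral_eq_lintegral_of_nonneg_ae hnn (hc.norm.pow 2).aestronglyMeasurable]
    simp_rw [he]
    exact ENNReal.toReal_mono hF.2.ne hle

theorem MemHardy.integral_norm_mul_norm_le (hF : MemHardy F) {s t : ℝ} (hs : 0 < s) (ht : 0 < t) :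
    Integrable (fun p => ‖F (slicePoint s p)‖ * ‖F (slicePoint t p)‖) ∧
      ∫ p, ‖F (slicePoint s p)‖ * ‖F (slicePoint t p)‖ ≤ (hardySup F).toReal := by
  obtain ⟨hs1, hs2⟩ := hF.integrable_norm_sq hs
  obtain ⟨ht1, ht2⟩ := hF.integrable_norm_sq ht
  have hc : ∀ {t : ℝ}, 0 < t → Continuous fun p : Heisenberg m => F (slicePoint t p) :=
    fun ht => continuous_comp_slicePoint hF.1.1.continuousOn continuous_const continuous_id
      fun _ => ht
  have hle : ∀ p : Heisenberg m, ‖F (slicePoint s p)‖ * ‖F (slicePoint t p)‖ ≤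
      2⁻¹ * (‖F (slicePoint s p)‖ ^ 2 + ‖F (slicePoint t p)‖ ^ 2) := fun p => by
    nlinarith [sq_nonneg (‖F (slicePoint s p)‖ - ‖F (slicePoint t p)‖)]
  have hint := (hs1.add ht1).const_mul 2⁻¹
  have hint2 : Integrable (fun p => ‖F (slicePoint s p)‖ * ‖F (slicePoint t p)‖) := by
    refine hint.mono' ((hc hs).norm.mul (hc ht).norm).aestronglyMeasurable
      (Eventually.of_forall fun p => ?_)
    rw [Real.norm_of_nonneg (by positivity)]
    exact hle p
  refine ⟨hint2, (integral_mono hint2 hint hle).trans ?_⟩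
  simp only [Pi.add_apply]
  rw [integral_const_mul, integral_add hs1 ht1]
  linarith

/-- The pairing of the slices at heights `t` and `s - t`, localized by a cutoff function, varies
slowly with `t` when the cutoff function does. -/
theorem MemHardy.abs_cutoff_pairing_sub_le (hF : MemHardy F) {χ : Heisenberg m → ℝ}
    (hχ : ContDiff ℝ 1 χ) (hχc : HasCompactSupport χ) {D : ℝ} (hD0 : 0 ≤ D)
    (hD : ∀ p j, |fderiv ℝ χ p (centreDir j)| ≤ D) {s a b : ℝ} (ha : a ∈ Set.Ioo 0 s)
    (hb : b ∈ Set.Ioo 0 s) :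
    |(∫ p, χ p * inner ℝ (F (slicePoint b p)) (F (slicePoint (s - b) p)))
      - ∫ p, χ p * inner ℝ (F (slicePoint a p)) (F (slicePoint (s - a) p))|
      ≤ 3 * D * (hardySup F).toReal * |b - a| := by
  have hc : ∀ {t : ℝ}, 0 < t → Continuous fun p : Heisenberg m => F (slicePoint t p) :=
    fun ht => continuous_comp_slicePoint hF.1.1.continuousOn continuous_const continuous_id
      fun _ => ht
  have hci : ∀ j {t : ℝ}, 0 < t → Continuous fun p : Heisenberg m => imDeriv F j (slicePoint t p) :=
    fun j _ ht => continuous_comp_slicePoint (hF.1.continuousOn_fderiv_apply _) continuous_const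
      continuous_id fun _ => ht
  set K := tsupport χ with hKdef
  have hK : IsCompact K := hχc
  set f : ℝ → Heisenberg m → ℝ := fun t p =>
    χ p * inner ℝ (F (slicePoint t p)) (F (slicePoint (s - t) p)) with hf
  -- Here g j is the central derivative ∂_j of ⟨F_t, e_j F_{s-t}⟩, so f', the t-derivative of f, is
  -- the cutoff times a divergence.
  set g : Fin 3 → ℝ → Heisenberg m → ℝ := fun j t p =>
    inner ℝ (imDeriv F j (slicePoint t p)) (imUnit j * F (slicePoint (s - t) p))
      + inner ℝ (F (slicePoint t p)) (imUnit j * imDeriv F j (slicePoint (s - t) p)) with hg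
  set f' : ℝ → Heisenberg m → ℝ := fun t p => χ p * ∑ j, g j t p with hf'
  have hcomp : ∀ {h : HSpace m → ℍ[ℝ]}, ContinuousOn h (siegelHalfSpace m) →
      ContinuousOn (fun x : ℝ × Heisenberg m => h (slicePoint x.1 x.2)) (Set.Ioo 0 s ×ˢ K) := by
    intro h hh
    rw [continuousOn_iff_continuous_domRestrict]
    exact continuous_comp_slicePoint (t := fun x : Set.Ioo 0 s ×ˢ K => x.1.1)
      (p := fun x => x.1.2) hh (by fun_prop) (by fun_prop) fun x => x.2.1.1
  have hcomp' : ∀ {h : HSpace m → ℍ[ℝ]}, ContinuousOn h (siegelHalfSpace m) →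
      ContinuousOn (fun x : ℝ × Heisenberg m => h (slicePoint (s - x.1) x.2))
        (Set.Ioo 0 s ×ˢ K) := by
    intro h hh
    rw [continuousOn_iff_continuous_domRestrict]
    exact continuous_comp_slicePoint (t := fun x : Set.Ioo 0 s ×ˢ K => s - x.1.1)
      (p := fun x => x.1.2) hh (by fun_prop) (by fun_prop) fun x => by
        have := x.2.1.2
        linarith
  have hFc := hF.1.1.continuousOn
  have hderiv : ∀ t ∈ Set.Ioo 0 s, HasDerivAt (fun t => ∫ p in K, f t p) (∫ p in K, f' t p) t := by
    intro t ht
    refine hasDerivAt_setIntegral_of_isCompact hK isOpen_Ioo ?_ ?_ ?_ ht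
    · exact (hχ.continuous.comp continuous_snd).continuousOn.mul ((hcomp hFc).inner (hcomp' hFc))
    · refine (hχ.continuous.comp continuous_snd).continuousOn.mul
        (continuousOn_finsetSum _ fun j _ => ?_)
      have hij := hF.1.continuousOn_fderiv_apply (Pi.single 0 (imUnit j))
      exact ((hcomp hij).inner (continuousOn_const.mul (hcomp' hFc))).add
        ((hcomp hFc).inner (continuousOn_const.mul (hcomp' hij)))
    · intro t ht p _
      have hst : 0 < s - t := by linarith [ht.2]
      have h1 := hF.1.hasDerivAt_slicePoint ht.1 p
      have h2 := (hF.1.hasDerivAt_slicePoint hst p).comp_const_sub s t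
      have h3 := (h1.inner ℝ h2).const_mul (χ p)
      refine h3.congr_deriv ?_
      simp only [hf', hg, inner_neg_left, neg_neg, inner_sum, sum_inner,
        inner_imUnit_mul_left, Finset.sum_neg_distrib, Finset.sum_add_distrib]
      ring
  have hfK : ∀ t, ∫ p in K, f t p = ∫ p, f t p := fun t =>
    setIntegral_eq_integral_of_forall_compl_eq_zero fun p hp => by
      simp [hf, image_eq_zero_of_notMem_tsupport hp]
  have hf'K : ∀ t, ∫ p in K, f' t p = ∫ p, f' t p := fun t =>
    setIntegral_eq_integral_of_forall_compl_eq_zero fun p hp => by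
      simp [hf', image_eq_zero_of_notMem_tsupport hp]
  have hbound : ∀ t ∈ Set.Ioo 0 s, ‖∫ p in K, f' t p‖ ≤ 3 * D * (hardySup F).toReal := by
    intro t ht
    have ht0 : 0 < t := ht.1
    have hst : 0 < s - t := by linarith [ht.2]
    obtain ⟨hi1, hi2⟩ := hF.integral_norm_mul_norm_le ht0 hst
    have hj : ∀ j, Integrable (fun p => χ p * g j t p) ∧
        |∫ p, χ p * g j t p| ≤ D * (hardySup F).toReal := by
      intro j
      have hgc : Continuous fun p => χ p * g j t p :=
        hχ.continuous.mul ((Continuous.inner (hci j ht0) (continuous_const.mul (hc hst))).add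
          (Continuous.inner (hc ht0) (continuous_const.mul (hci j hst))))
      have hzc : Continuous fun p =>
          inner ℝ (F (slicePoint t p)) (imUnit j * F (slicePoint (s - t) p)) :=
        Continuous.inner (hc ht0) (continuous_const.mul (hc hst))
      have hgi : Integrable (fun p => χ p * g j t p) :=
        hgc.integrable_of_hasCompactSupport hχc.mul_right
      have hdχ : Continuous fun p => fderiv ℝ χ p (centreDir j) :=
        (hχ.continuous_fderiv one_ne_zero).clm_apply continuous_const
      have hdχc : HasCompactSupport fun p => fderiv ℝ χ p (centreDir j) :=
        hχc.fderiv_apply ℝ _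
      have hki : Integrable (fun p => fderiv ℝ χ p (centreDir j) *
          inner ℝ (F (slicePoint t p)) (imUnit j * F (slicePoint (s - t) p))) :=
        (hdχ.mul hzc).integrable_of_hasCompactSupport hdχc.mul_right
      have hzi : Integrable (fun p => χ p *
          inner ℝ (F (slicePoint t p)) (imUnit j * F (slicePoint (s - t) p))) :=
        (hχ.continuous.mul hzc).integrable_of_hasCompactSupport hχc.mul_right
      -- Integration by parts moves ∂_j onto χ, where it costs D. The three central directions
      -- produce the factor 3.
      have h0 := integral_eq_zero_of_hasLineDerivAt (v := centreDir j) hzi (hki.add hgi) (by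
        intro p
        have h1 := (hχ.differentiable one_ne_zero p).hasFDerivAt.hasLineDerivAt (centreDir j)
        have h2 := hF.1.hasLineDerivAt_slicePoint ht0 p j
        have h3 := hF.1.hasLineDerivAt_slicePoint hst p j
        rw [HasLineDerivAt] at h1 h2 h3 ⊢
        have h4 := h1.mul (h2.inner ℝ (h3.const_mul (imUnit j)))
        refine h4.congr_deriv ?_
        simp only [hg, zero_smul, add_zero, Pi.add_apply]
        ring)
      simp only [Pi.add_apply] at h0
      rw [integral_add hki hgi] at h0
      refine ⟨hgi, ?_⟩
      rw [eq_neg_of_add_eq_zero_right h0, abs_neg]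
      refine (abs_integral_le_integral_abs).trans ?_
      refine (integral_mono hki.abs (hi1.const_mul D) fun p => ?_).trans ?_
      · simp only
        rw [abs_mul]
        refine mul_le_mul (hD p j) ?_ (abs_nonneg _) hD0
        refine (abs_real_inner_le_norm _ _).trans ?_
        rw [norm_mul, norm_imUnit, one_mul]
      · rw [integral_const_mul]
        exact mul_le_mul_of_nonneg_left hi2 hD0
    rw [hf'K]
    simp only [hf', Finset.mul_sum]
    rw [integral_finsetSum _ fun j _ => (hj j).1, Real.norm_eq_abs]
    refine (Finset.abs_sum_le_sum_abs _ _).trans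
      ((Finset.sum_le_sum fun j _ => (hj j).2).trans (le_of_eq ?_))
    simp
    ring
  have h := (convex_Ioo 0 s).norm_image_sub_le_of_norm_hasDerivWithin_le
    (fun t ht => (hderiv t ht).hasDerivWithinAt) hbound ha hb
  simp only [hfK] at h
  simpa [hf] using h

/-- The pairing of the slices at two heights depends only on the sum of the heights. -/
theorem MemHardy.pairing_eq (hF : MemHardy F) {a b c d : ℝ} (ha : 0 < a) (hb : 0 < b)
    (hc : 0 < c) (hd : 0 < d) (habcd : a + b = c + d) :
    ∫ p : Heisenberg m, inner ℝ (F (slicePoint a p)) (F (slicePoint b p))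
      = ∫ p : Heisenberg m, inner ℝ (F (slicePoint c p)) (F (slicePoint d p)) := by
  -- The dilated cutoffs χ(p/(n+1)) are bounded by 1 and tend to 1 pointwise, while their central
  -- derivatives are at most C/(n+1). The error bound therefore tends to 0.
  let χ : ContDiffBump (0 : Heisenberg m) := ⟨1, 2, one_pos, one_lt_two⟩
  have hχ : ContDiff ℝ 1 χ := χ.contDiff
  have hbd : ∃ C : ℝ, 0 ≤ C ∧ ∀ p j, |fderiv ℝ χ p (centreDir j)| ≤ C := by
    have h : ∀ j : Fin 3, ∃ C, ∀ p, ‖fderiv ℝ χ p (centreDir j)‖ ≤ C := fun j =>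
      (((hχ.continuous_fderiv one_ne_zero).clm_apply continuous_const)).bounded_above_of_compact_support
        (χ.hasCompactSupport.fderiv_apply ℝ _)
    choose C hC using h
    refine ⟨∑ j, |C j|, Finset.sum_nonneg fun _ _ => abs_nonneg _, fun p j => ?_⟩
    exact (hC j p).trans ((le_abs_self _).trans
      (Finset.single_le_sum (f := fun j => |C j|) (fun _ _ => abs_nonneg _) (Finset.mem_univ j)))
  obtain ⟨C, hC0, hC⟩ := hbd
  have hr : ∀ n : ℕ, (0 : ℝ) < ((n : ℝ) + 1)⁻¹ := fun n => by positivity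
  have hlim : ∀ {s t : ℝ}, 0 < s → 0 < t → Tendsto (fun n : ℕ => ∫ p : Heisenberg m,
      χ (((n : ℝ) + 1)⁻¹ • p) * inner ℝ (F (slicePoint s p)) (F (slicePoint t p))) atTop
      (𝓝 (∫ p : Heisenberg m, inner ℝ (F (slicePoint s p)) (F (slicePoint t p)))) := by
    intro s t hs ht
    have hcF : ∀ {t : ℝ}, 0 < t → Continuous fun p : Heisenberg m => F (slicePoint t p) :=
      fun ht => continuous_comp_slicePoint hF.1.1.continuousOn continuous_const continuous_id
        fun _ => ht
    refine tendsto_integral_of_dominated_convergence _ (fun n => ?_)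
      (hF.integral_norm_mul_norm_le hs ht).1 (fun n => Eventually.of_forall fun p => ?_)
      (Eventually.of_forall fun p => ?_)
    · exact ((χ.continuous.comp (continuous_const_smul _)).mul
        (Continuous.inner (hcF hs) (hcF ht))).aestronglyMeasurable
    · rw [norm_mul, Real.norm_of_nonneg χ.nonneg, Real.norm_eq_abs]
      exact (mul_le_of_le_one_left (abs_nonneg _) χ.le_one).trans (abs_real_inner_le_norm _ _)
    · have hz : Tendsto (fun n : ℕ => ((n : ℝ) + 1)⁻¹ • p) atTop (𝓝 0) := by
        have := tendsto_one_div_add_atTop_nhds_zero_nat (𝕜 := ℝ)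
        simpa [one_div] using this.smul_const p
      have h1 : Tendsto (fun n : ℕ => χ (((n : ℝ) + 1)⁻¹ • p)) atTop (𝓝 1) := by
        have := (χ.continuous.tendsto 0).comp hz
        rwa [χ.one_of_mem_closedBall (Metric.mem_closedBall_self χ.rIn_pos.le)] at this
      simpa using h1.mul_const (inner ℝ (F (slicePoint s p)) (F (slicePoint t p)))
  have hdiff := ((hlim hc hd).sub (hlim ha hb)).abs
  have hzero : Tendsto (fun n : ℕ => 3 * (((n : ℝ) + 1)⁻¹ * C) * (hardySup F).toReal * |c - a|)
      atTop (𝓝 0) := by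
    have h1 := tendsto_one_div_add_atTop_nhds_zero_nat (𝕜 := ℝ)
    simp only [one_div] at h1
    simpa using ((((h1.mul_const C).const_mul 3).mul_const (hardySup F).toReal).mul_const |c - a|)
  have hle := le_of_tendsto_of_tendsto' hdiff hzero fun n => by
    have hs : ContDiff ℝ 1 fun p : Heisenberg m => χ (((n : ℝ) + 1)⁻¹ • p) :=
      hχ.comp (contDiff_const_smul _)
    have hcs : HasCompactSupport fun p : Heisenberg m => χ (((n : ℝ) + 1)⁻¹ • p) :=
      χ.hasCompactSupport.comp_homeomorph (Homeomorph.smulOfNeZero _ (hr n).ne')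
    have key := hF.abs_cutoff_pairing_sub_le hs hcs (D := ((n : ℝ) + 1)⁻¹ * C)
      (mul_nonneg (hr n).le hC0) (fun p j => by
        have h1 : HasFDerivAt (fun p : Heisenberg m => χ (((n : ℝ) + 1)⁻¹ • p))
            ((fderiv ℝ χ (((n : ℝ) + 1)⁻¹ • p)).comp
              (((n : ℝ) + 1)⁻¹ • ContinuousLinearMap.id ℝ (Heisenberg m))) p :=
          (hχ.differentiable one_ne_zero _).hasFDerivAt.comp p
            (((((n : ℝ) + 1)⁻¹ • ContinuousLinearMap.id ℝ (Heisenberg m))).hasFDerivAt)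
        rw [h1.fderiv]
        simp only [ContinuousLinearMap.comp_apply, smul_apply,
          ContinuousLinearMap.id_apply, map_smul, smul_eq_mul, abs_mul, abs_of_pos (hr n)]
        exact mul_le_mul_of_nonneg_left (hC _ j) (hr n).le)
      (s := a + b) (a := a) (b := c) ⟨ha, by linarith⟩ ⟨hc, by linarith⟩
    have e1 : a + b - a = b := by ring
    have e2 : a + b - c = d := by linarith
    rwa [e1, e2] at key
  have := abs_eq_zero.1 (le_antisymm hle (abs_nonneg _))
  linarith

end

/-! ### Existence, uniqueness and norm of the boundary value -/

noncomputable section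

variable {m : ℕ} {F : HSpace m → ℍ[ℝ]}

theorem eLpNorm_two_sq {α E : Type*} [MeasurableSpace α] [NormedAddCommGroup E] (g : α → E)
    (μ : Measure α) : eLpNorm g 2 μ ^ 2 = ∫⁻ x, ‖g x‖ₑ ^ 2 ∂μ := by
  have h := eLpNorm_nnreal_pow_eq_lintegral (f := g) (μ := μ) (p := 2) two_ne_zero
  simpa using h

/-- The translate of a Hardy function, as an element of `L²(∂𝒰ₙ)`. -/
def sliceLp (hF : MemHardy F) (t : ℝ) : BoundaryL2 m :=
  -- The default 0 at t ≤ 0 is invisible to limits along `𝓝[>] 0`.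
  if ht : 0 < t then (hF.memLp ht).toLp else 0

theorem coeFn_sliceLp (hF : MemHardy F) {t : ℝ} (ht : 0 < t) :
    sliceLp hF t =ᵐ[boundaryMeasure m] verticalTranslate F t := by
  rw [sliceLp, dif_pos ht]
  exact MemLp.coeFn_toLp _

theorem enorm_sliceLp_sq (hF : MemHardy F) {t : ℝ} (ht : 0 < t) :
    ‖sliceLp hF t‖ₑ ^ 2 = ∫⁻ q, ‖verticalTranslate F t q‖ₑ ^ 2 ∂(boundaryMeasure m) := by
  rw [← eLpNorm_two_sq, Lp.enorm_def, eLpNorm_congr_ae (coeFn_sliceLp hF ht)]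

theorem enorm_sliceLp_sq_le (hF : MemHardy F) {t : ℝ} (ht : 0 < t) :
    ‖sliceLp hF t‖ₑ ^ 2 ≤ hardySup F :=
  (enorm_sliceLp_sq hF ht).trans_le (lintegral_le_hardySup F ht)

theorem norm_sliceLp_sq_le (hF : MemHardy F) {t : ℝ} (ht : 0 < t) :
    ‖sliceLp hF t‖ ^ 2 ≤ (hardySup F).toReal := by
  have h := ENNReal.toReal_mono hF.2.ne (enorm_sliceLp_sq_le hF ht)
  rwa [ENNReal.toReal_pow, toReal_enorm] at h

theorem inner_sliceLp (hF : MemHardy F) {s t : ℝ} (hs : 0 < s) (ht : 0 < t) :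
    inner ℝ (sliceLp hF s) (sliceLp hF t)
      = ∫ p : Heisenberg m, inner ℝ (F (slicePoint s p)) (F (slicePoint t p)) := by
  rw [L2.inner_def]
  have h : (fun q => inner ℝ (sliceLp hF s q) (sliceLp hF t q)) =ᵐ[boundaryMeasure m]
      fun q => inner ℝ (verticalTranslate F s q) (verticalTranslate F t q) := by
    filter_upwards [coeFn_sliceLp hF hs, coeFn_sliceLp hF ht] with q h1 h2
    rw [h1, h2]
  rw [integral_congr_ae h, integral_boundaryMeasure]
  rfl

/-- Rephrased as convergence in the Hilbert space, the boundary value falls under the abstract curve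
lemma and the uniqueness of limits. -/
theorem hasBoundaryValue_iff (hF : MemHardy F) (f : BoundaryL2 m) :
    HasBoundaryValue F f ↔ Tendsto (sliceLp hF) (𝓝[>] 0) (𝓝 f) := by
  rw [tendsto_iff_edist_tendsto_0]
  have h : (fun t => edist (sliceLp hF t) f) =ᶠ[𝓝[>] 0]
      fun t => eLpNorm (verticalTranslate F t - ⇑f) 2 (boundaryMeasure m) := by
    filter_upwards [self_mem_nhdsWithin] with t ht
    rw [Lp.edist_def]
    exact eLpNorm_congr_ae ((coeFn_sliceLp hF ht).sub EventuallyEq.rfl)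
  rw [tendsto_congr' h]
  exact ⟨fun h => h.2, fun h => ⟨fun t ht => hF.memLp ht, h⟩⟩

theorem MemHardy.exists_hasBoundaryValue (hF : MemHardy F) :
    ∃ f : BoundaryL2 m, HasBoundaryValue F f := by
  obtain ⟨f, hf, -⟩ := exists_tendsto_of_inner_eq (u := sliceLp hF)
    (fun t ht => norm_sliceLp_sq_le hF ht) (fun a ha b hb c hc d hd h => by
      rw [inner_sliceLp hF ha hb, inner_sliceLp hF hc hd, hF.pairing_eq ha hb hc hd h])
  exact ⟨f, (hasBoundaryValue_iff hF f).2 hf⟩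

theorem HasBoundaryValue.unique {f g : BoundaryL2 m} (hF : MemHardy F)
    (hf : HasBoundaryValue F f) (hg : HasBoundaryValue F g) : f = g :=
  tendsto_nhds_unique ((hasBoundaryValue_iff hF f).1 hf) ((hasBoundaryValue_iff hF g).1 hg)

/-- The limit dominates every slice in norm, and its own norm is a limit of slice norms, each
bounded by the supremum. -/
theorem HasBoundaryValue.hardySup_eq {f : BoundaryL2 m} (hF : MemHardy F)
    (hf : HasBoundaryValue F f) : hardySup F = ‖f‖ₑ ^ 2 := by
  obtain ⟨g, hg, hle⟩ := exists_tendsto_of_inner_eq (u := sliceLp hF)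
    (fun t ht => norm_sliceLp_sq_le hF ht) (fun a ha b hb c hc d hd h => by
      rw [inner_sliceLp hF ha hb, inner_sliceLp hF hc hd, hF.pairing_eq ha hb hc hd h])
  obtain rfl := HasBoundaryValue.unique hF hf ((hasBoundaryValue_iff hF g).2 hg)
  refine le_antisymm (iSup₂_le fun t ht => ?_) ?_
  · rw [← enorm_sliceLp_sq hF ht]
    exact pow_le_pow_left₀ (zero_le) (enorm_le_iff_norm_le.2 (hle t ht)) 2
  · have h : Tendsto (fun t => ‖sliceLp hF t‖ₑ ^ 2) (𝓝[>] 0) (𝓝 (‖f‖ₑ ^ 2)) :=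
      ((ENNReal.continuous_pow 2).tendsto _).comp ((continuous_enorm.tendsto f).comp hg)
    refine le_of_tendsto h ?_
    filter_upwards [self_mem_nhdsWithin] with t ht using enorm_sliceLp_sq_le hF ht

theorem HasBoundaryValue.norm_eq {f : BoundaryL2 m} (hF : MemHardy F)
    (hf : HasBoundaryValue F f) : ‖f‖ = hardyNorm F := by
  rw [hardyNorm, hf.hardySup_eq hF, ENNReal.toReal_pow, toReal_enorm, Real.sqrt_sq (norm_nonneg _)]

/-! ### Linear structure -/

theorem fderiv_apply_mul_const {q : HSpace m} (h : DifferentiableAt ℝ F q) (c : ℍ[ℝ])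
    (v : HSpace m) : fderiv ℝ (fun q => F q * c) q v = fderiv ℝ F q v * c := by
  rw [(h.hasFDerivAt.mul_const' c).fderiv]
  simp

theorem IsRegularOn.zero : IsRegularOn (0 : HSpace m → ℍ[ℝ]) (siegelHalfSpace m) :=
  ⟨contDiffOn_const, fun q _ l => by simp [cauchyFueter]⟩

theorem IsRegularOn.add {G : HSpace m → ℍ[ℝ]} (hF : IsRegularOn F (siegelHalfSpace m))
    (hG : IsRegularOn G (siegelHalfSpace m)) : IsRegularOn (F + G) (siegelHalfSpace m) := by
  refine ⟨hF.1.add hG.1, fun q hq l => ?_⟩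
  have h1 := hF.2 q hq l
  have h2 := hG.2 q hq l
  rw [cauchyFueter_eq_sum] at h1 h2 ⊢
  rw [((hF.hasFDerivAt hq).add (hG.hasFDerivAt hq)).fderiv]
  simp only [add_apply, mul_add, Finset.sum_add_distrib]
  rw [add_add_add_comm, h1, h2, add_zero]

theorem IsRegularOn.mul_const (hF : IsRegularOn F (siegelHalfSpace m)) (c : ℍ[ℝ]) :
    IsRegularOn (fun q => F q * c) (siegelHalfSpace m) := by
  refine ⟨hF.1.mul contDiffOn_const, fun q hq l => ?_⟩
  have h1 := hF.2 q hq l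
  have hd := (hF.hasFDerivAt hq).differentiableAt
  rw [cauchyFueter_eq_sum] at h1 ⊢
  simp only [fderiv_apply_mul_const hd, ← mul_assoc]
  rw [← Finset.sum_mul, ← add_mul, h1, zero_mul]

theorem MemHardy.zero : MemHardy (0 : HSpace m → ℍ[ℝ]) :=
  ⟨IsRegularOn.zero, by simp [hardySup, verticalTranslate]⟩

theorem MemHardy.of_eLpNorm_le (hF : IsRegularOn F (siegelHalfSpace m)) {C : ℝ≥0∞} (hC : C < ∞)
    (h : ∀ t > 0, eLpNorm (verticalTranslate F t) 2 (boundaryMeasure m) ≤ C) : MemHardy F := by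
  refine ⟨hF, lt_of_le_of_lt (iSup₂_le fun t ht => ?_) (ENNReal.pow_lt_top hC (n := 2))⟩
  rw [← eLpNorm_two_sq]
  exact pow_le_pow_left₀ zero_le (h t ht) 2

theorem eLpNorm_verticalTranslate_sq_le (F : HSpace m → ℍ[ℝ]) {t : ℝ} (ht : 0 < t) :
    eLpNorm (verticalTranslate F t) 2 (boundaryMeasure m) ^ 2 ≤ hardySup F := by
  rw [eLpNorm_two_sq]
  exact lintegral_le_hardySup F ht

theorem eLpNorm_verticalTranslate_le (F : HSpace m → ℍ[ℝ]) {t : ℝ} (ht : 0 < t) :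
    eLpNorm (verticalTranslate F t) 2 (boundaryMeasure m) ≤ hardySup F ^ (1 / 2 : ℝ) := by
  rw [one_div, ENNReal.le_rpow_inv_iff two_pos]
  simpa using eLpNorm_verticalTranslate_sq_le F ht

theorem MemHardy.add {G : HSpace m → ℍ[ℝ]} (hF : MemHardy F) (hG : MemHardy G) :
    MemHardy (F + G) := by
  refine MemHardy.of_eLpNorm_le (hF.1.add hG.1)
    (C := hardySup F ^ (1 / 2 : ℝ) + hardySup G ^ (1 / 2 : ℝ)) ?_ fun t ht => ?_
  · exact ENNReal.add_lt_top.2 ⟨ENNReal.rpow_lt_top_of_nonneg (by norm_num) hF.2.ne,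
      ENNReal.rpow_lt_top_of_nonneg (by norm_num) hG.2.ne⟩
  · exact (eLpNorm_add_le (hF.memLp ht).1 (hG.memLp ht).1 one_le_two).trans
      (add_le_add (eLpNorm_verticalTranslate_le F ht) (eLpNorm_verticalTranslate_le G ht))

theorem MemHardy.mul_const (hF : MemHardy F) (c : ℍ[ℝ]) : MemHardy fun q => F q * c := by
  refine MemHardy.of_eLpNorm_le (hF.1.mul_const c)
    (C := ‖MulOpposite.op c‖ₑ * hardySup F ^ (1 / 2 : ℝ)) ?_ fun t ht => ?_
  · exact ENNReal.mul_lt_top enorm_lt_top (ENNReal.rpow_lt_top_of_nonneg (by norm_num) hF.2.ne)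
  -- Right multiplication by c is the scalar action of `MulOpposite.op c`.
  · exact (eLpNorm_const_smul_le (c := MulOpposite.op c) (f := verticalTranslate F t)).trans
      (mul_le_mul_right (eLpNorm_verticalTranslate_le F ht) _)

theorem HasBoundaryValue.add {G : HSpace m → ℍ[ℝ]} {f g : BoundaryL2 m} (hF : MemHardy F)
    (hG : MemHardy G) (hf : HasBoundaryValue F f) (hg : HasBoundaryValue G g) :
    HasBoundaryValue (F + G) (f + g) := by
  rw [hasBoundaryValue_iff hF] at hf
  rw [hasBoundaryValue_iff hG] at hg
  rw [hasBoundaryValue_iff (hF.add hG)]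
  refine (hf.add hg).congr' ?_
  filter_upwards [self_mem_nhdsWithin] with t ht
  refine Lp.ext ?_
  filter_upwards [Lp.coeFn_add (sliceLp hF t) (sliceLp hG t), coeFn_sliceLp hF ht,
    coeFn_sliceLp hG ht, coeFn_sliceLp (hF.add hG) ht] with q h1 h2 h3 h4
  rw [h1, h4, Pi.add_apply, h2, h3]
  rfl

theorem HasBoundaryValue.mul_const {f : BoundaryL2 m} (hF : MemHardy F)
    (hf : HasBoundaryValue F f) (c : ℍ[ℝ]) :
    HasBoundaryValue (fun q => F q * c) (MulOpposite.op c • f) := by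
  rw [hasBoundaryValue_iff hF] at hf
  rw [hasBoundaryValue_iff (hF.mul_const c)]
  refine (hf.const_smul (MulOpposite.op c)).congr' ?_
  filter_upwards [self_mem_nhdsWithin] with t ht
  refine Lp.ext ?_
  filter_upwards [Lp.coeFn_smul (MulOpposite.op c) (sliceLp hF t), coeFn_sliceLp hF ht,
    coeFn_sliceLp (hF.mul_const c) ht] with q h1 h2 h3
  rw [h1, h3, Pi.smul_apply, h2]
  rfl

theorem HasBoundaryValue.zero : HasBoundaryValue (0 : HSpace m → ℍ[ℝ]) 0 := by
  rw [hasBoundaryValue_iff MemHardy.zero]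
  refine tendsto_const_nhds.congr' ?_
  filter_upwards [self_mem_nhdsWithin] with t ht
  refine Lp.ext ?_
  filter_upwards [Lp.coeFn_zero ℍ[ℝ] 2 (boundaryMeasure m),
    coeFn_sliceLp (MemHardy.zero (m := m)) ht] with q h1 h2
  rw [h1, h2]
  rfl

/-- The boundary values of Hardy functions form a right `ℍ`-linear subspace of `L²(∂𝒰ₙ)`. -/
def boundaryValues (m : ℕ) : Submodule ℍ[ℝ]ᵐᵒᵖ (BoundaryL2 m) where
  carrier := {f | ∃ F, MemHardy F ∧ HasBoundaryValue F f}
  add_mem' := by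
    rintro f g ⟨F, hF, hf⟩ ⟨G, hG, hg⟩
    exact ⟨F + G, hF.add hG, hf.add hF hG hg⟩
  zero_mem' := ⟨0, MemHardy.zero, HasBoundaryValue.zero⟩
  smul_mem' := by
    rintro c f ⟨F, hF, hf⟩
    exact ⟨_, hF.mul_const c.unop, hf.mul_const hF c.unop⟩

end

noncomputable section

variable {m : ℕ} {F : HSpace m → ℍ[ℝ]}

/-! ### The mean value property -/

/-- Real coordinates on `ℍⁿ`, with the real part of the first variable singled out. -/
abbrev RealCoord (m : ℕ) : Type := ℝ × Heisenberg m

/-- The linear identification of the real coordinate space with `ℍⁿ`. -/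
def coordLinearEquiv (m : ℕ) : RealCoord m ≃ₗ[ℝ] HSpace m where
  toFun x := Fin.cons (quat x.1 (x.2.1 0) (x.2.1 1) (x.2.1 2))
    (fun l => quat (x.2.2 l 0) (x.2.2 l 1) (x.2.2 l 2) (x.2.2 l 3))
  invFun q := ((q 0).re, ![(q 0).imI, (q 0).imJ, (q 0).imK],
    fun l => ![(q l.succ).re, (q l.succ).imI, (q l.succ).imJ, (q l.succ).imK])
  left_inv x := by
    obtain ⟨t, v, y⟩ := x
    refine Prod.ext (by simp) (Prod.ext ?_ ?_)
    · funext i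
      fin_cases i <;> simp
    · funext l i
      fin_cases i <;> simp
  right_inv q := by
    funext l
    refine Fin.cases ?_ (fun i => ?_) l <;> simp [quat_eta]
  map_add' x y := by
    funext l
    refine Fin.cases ?_ (fun i => ?_) l <;> ext <;> simp
  map_smul' c x := by
    funext l
    refine Fin.cases ?_ (fun i => ?_) l <;> ext <;> simp

/-- The linear homeomorphism of the real coordinate space with `ℍⁿ`. -/
def coordEquiv (m : ℕ) : RealCoord m ≃L[ℝ] HSpace m :=
  (coordLinearEquiv m).toContinuousLinearEquiv

instance instIsAddHaarMeasureRealCoord :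
    (volume : Measure (RealCoord m)).IsAddHaarMeasure :=
  Measure.prod.instIsAddHaarMeasure (volume : Measure ℝ) (volume : Measure (Heisenberg m))

/-- The sum of the squared norms of all coordinates. -/
def totalNormSq (q : HSpace m) : ℝ := ∑ l, ‖q l‖ ^ 2

/-- The real Euclidean inner product on `ℍⁿ`. -/
def pairing (q w : HSpace m) : ℝ := ∑ l, inner ℝ (q l) (w l)

/-- A smooth radial function supported in the Euclidean unit ball. -/
def bump (q : HSpace m) : ℝ := Real.smoothTransition (1 - totalNormSq q)

/-- The factor `κ` for which the gradient of `bump` at `q` is `κ q • q`. -/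
def bumpSlope (q : HSpace m) : ℝ := -(2 * deriv Real.smoothTransition (1 - totalNormSq q))

/-- The Euclidean unit ball in real coordinates. -/
def unitBall (m : ℕ) : Set (RealCoord m) := {y | totalNormSq (coordEquiv m y) ≤ 1}

theorem continuous_totalNormSq : Continuous (totalNormSq : HSpace m → ℝ) :=
  continuous_finsetSum _ fun l _ => ((continuous_apply l).norm.pow 2)

theorem continuous_bump : Continuous (bump : HSpace m → ℝ) :=
  Real.smoothTransition.continuous.comp (continuous_const.sub continuous_totalNormSq)

theorem continuous_bumpSlope : Continuous (bumpSlope : HSpace m → ℝ) := by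
  have h : Continuous (deriv Real.smoothTransition) :=
    (Real.smoothTransition.contDiff (n := 1)).continuous_deriv le_rfl
  exact (continuous_const.mul (h.comp (continuous_const.sub continuous_totalNormSq))).neg

theorem bump_nonneg (q : HSpace m) : 0 ≤ bump q := Real.smoothTransition.nonneg _

theorem bump_le_one (q : HSpace m) : bump q ≤ 1 := Real.smoothTransition.le_one _

theorem bump_eq_zero {q : HSpace m} (hq : 1 < totalNormSq q) : bump q = 0 :=
  Real.smoothTransition.zero_of_nonpos (by linarith)

theorem bumpSlope_eq_zero {q : HSpace m} (hq : 1 < totalNormSq q) : bumpSlope q = 0 := by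
  have h : Real.smoothTransition =ᶠ[𝓝 (1 - totalNormSq q)] fun _ => 0 := by
    filter_upwards [Iio_mem_nhds (show 1 - totalNormSq q < 0 by linarith)] with s hs
    exact Real.smoothTransition.zero_of_nonpos (le_of_lt hs)
  rw [bumpSlope, h.deriv_eq]
  simp

theorem norm_le_of_totalNormSq_le {q : HSpace m} (hq : totalNormSq q ≤ 1) : ‖q‖ ≤ 1 := by
  refine (pi_norm_le_iff_of_nonneg zero_le_one).2 fun l => ?_
  have h : ‖q l‖ ^ 2 ≤ totalNormSq q :=
    Finset.single_le_sum (f := fun l => ‖q l‖ ^ 2) (fun _ _ => by positivity) (Finset.mem_univ l)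
  nlinarith [norm_nonneg (q l)]

/-- The chain rule applies to |q|², whose gradient is 2q. Radiality of the weight is what later
makes the second-order moments symmetric. -/
theorem hasLineDerivAt_bump (q w : HSpace m) :
    HasLineDerivAt ℝ bump (bumpSlope q * pairing q w) q w := by
  have h1 : HasDerivAt (fun τ : ℝ => totalNormSq (q + τ • w)) (2 * pairing q w) 0 := by
    simp only [totalNormSq, pairing, Finset.mul_sum]
    refine HasDerivAt.fun_sum fun l _ => ?_
    have h : HasDerivAt (fun τ : ℝ => (q + τ • w) l) (w l) 0 := by
      simpa using ((hasDerivAt_id (0 : ℝ)).smul_const (w l)).const_add (q l)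
    simpa using h.norm_sq
  have h2 : HasDerivAt Real.smoothTransition (deriv Real.smoothTransition (1 - totalNormSq q))
      (1 - totalNormSq (q + (0 : ℝ) • w)) := by
    rw [zero_smul, add_zero]
    exact ((Real.smoothTransition.contDiff (n := 1)).differentiable one_ne_zero _).hasDerivAt
  have h3 := h2.comp (0 : ℝ) (h1.const_sub 1)
  rw [HasLineDerivAt]
  refine h3.congr_deriv ?_
  simp only [bumpSlope]
  ring

theorem isCompact_unitBall : IsCompact (unitBall m) := by
  have h : IsCompact {q : HSpace m | totalNormSq q ≤ 1} := by
    refine (isCompact_closedBall (0 : HSpace m) 1).of_isClosed_subset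
      (isClosed_le continuous_totalNormSq continuous_const) fun q hq => ?_
    rw [mem_closedBall_zero_iff]
    exact norm_le_of_totalNormSq_le hq
  exact (coordEquiv m).toHomeomorph.isClosedEmbedding.isCompact_preimage h

/-- The mass of the bump function. -/
def bumpMass (m : ℕ) : ℝ := ∫ y : RealCoord m, bump (coordEquiv m y)

theorem bumpMass_pos : 0 < bumpMass m := by
  have hc : Continuous fun y : RealCoord m => bump (coordEquiv m y) :=
    continuous_bump.comp (coordEquiv m).continuous
  have hs : HasCompactSupport fun y : RealCoord m => bump (coordEquiv m y) :=
    HasCompactSupport.intro isCompact_unitBall fun y hy => bump_eq_zero (not_le.1 hy)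
  refine hc.integral_pos_of_hasCompactSupport_nonneg_nonzero hs (fun y => bump_nonneg _)
    (x := 0) ?_
  simp [bump, totalNormSq]

theorem integrable_of_continuousOn_of_isCompact {V E : Type*} [TopologicalSpace V] [T2Space V]
    [MeasurableSpace V] [OpensMeasurableSpace V] {μ : Measure V} [IsFiniteMeasureOnCompacts μ]
    [NormedAddCommGroup E] {B : Set V} (hB : IsCompact B) {g : V → E} (hg : ContinuousOn g B)
    (h0 : ∀ y ∉ B, g y = 0) : Integrable g μ :=
  (integrableOn_iff_integrable_of_support_subset
    (Function.support_subset_iff'.2 h0)).1 (hg.integrableOn_compact hB)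

section

variable {x : HSpace m} {r τ : ℝ}

theorem translate_mem (hx : Metric.ball x r ⊆ siegelHalfSpace m) (hτ : |τ| < r) {y : RealCoord m}
    (hy : y ∈ unitBall m) : x + τ • coordEquiv m y ∈ siegelHalfSpace m := by
  refine hx ?_
  rw [mem_ball_iff_norm, add_sub_cancel_left, norm_smul, Real.norm_eq_abs]
  have := norm_le_of_totalNormSq_le hy
  nlinarith [abs_nonneg τ]

theorem continuousOn_translate {E : Type*} [TopologicalSpace E] {g : HSpace m → E}
    (hg : ContinuousOn g (siegelHalfSpace m)) (hx : Metric.ball x r ⊆ siegelHalfSpace m)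
    (hτ : |τ| < r) : ContinuousOn (fun y => g (x + τ • coordEquiv m y)) (unitBall m) := by
  have h : Continuous fun y => x + τ • coordEquiv m y :=
    continuous_const.add ((coordEquiv m).continuous.const_smul τ)
  exact hg.comp h.continuousOn fun y hy => translate_mem hx hτ hy

/-- The bump function times a translated and dilated copy of `F`. -/
def bumpMul (F : HSpace m → ℍ[ℝ]) (x : HSpace m) (τ : ℝ) (y : RealCoord m) : ℍ[ℝ] :=
  bump (coordEquiv m y) • F (x + τ • coordEquiv m y)

/-- The derivative of `bumpMul` in the direction `w`. -/
def bumpMulDeriv (F : HSpace m → ℍ[ℝ]) (x : HSpace m) (τ : ℝ) (w : HSpace m)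
    (y : RealCoord m) : ℍ[ℝ] :=
  (bumpSlope (coordEquiv m y) * pairing (coordEquiv m y) w) • F (x + τ • coordEquiv m y)
    + (bump (coordEquiv m y) * τ) • fderiv ℝ F (x + τ • coordEquiv m y) w

/-- Over the unit ball the argument of F stays in the half space. Off the ball the product vanishes
in a neighbourhood, so the derivative exists at every y, even where x + τy leaves the domain of
regularity. -/
theorem hasLineDerivAt_bumpMul (hF : IsRegularOn F (siegelHalfSpace m))
    (hx : Metric.ball x r ⊆ siegelHalfSpace m) (hτ : |τ| < r) (w : HSpace m) (y : RealCoord m) :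
    HasLineDerivAt ℝ (bumpMul F x τ) (bumpMulDeriv F x τ w y) y ((coordEquiv m).symm w) := by
  by_cases hy : y ∈ unitBall m
  · have h1 := hasLineDerivAt_bump (coordEquiv m y) w
    have h2 := (hF.hasFDerivAt (translate_mem hx hτ hy)).hasLineDerivAt (τ • w)
    rw [HasLineDerivAt] at h1 h2 ⊢
    have h3 := h1.smul h2
    have h4 : (fun s : ℝ => bumpMul F x τ (y + s • (coordEquiv m).symm w)) =
        fun s : ℝ => bump (coordEquiv m y + s • w) •
          F (x + τ • coordEquiv m y + s • τ • w) := by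
      funext s
      rw [bumpMul, map_add, map_smul, ContinuousLinearEquiv.apply_symm_apply, smul_add,
        smul_comm τ s w, add_assoc]
    rw [h4]
    refine h3.congr_deriv ?_
    rw [bumpMulDeriv, zero_smul, zero_smul, add_zero, add_zero, map_smul, smul_smul, add_comm]
  · have hy' : 1 < totalNormSq (coordEquiv m y) := not_le.1 hy
    have h0 : bumpMul F x τ =ᶠ[𝓝 y] fun _ => 0 := by
      have hc : Continuous fun y => totalNormSq (coordEquiv m y) :=
        continuous_totalNormSq.comp (coordEquiv m).continuous
      filter_upwards [hc.continuousAt.eventually (lt_mem_nhds hy')] with z hz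
      rw [bumpMul, bump_eq_zero hz, zero_smul]
    have e : bumpMulDeriv F x τ w y = 0 := by
      rw [bumpMulDeriv, bump_eq_zero hy', bumpSlope_eq_zero hy']
      simp
    rw [e]
    have h := (hasFDerivAt_const (𝕜 := ℝ) (0 : ℍ[ℝ]) y).congr_of_eventuallyEq h0
    simpa using h.hasLineDerivAt ((coordEquiv m).symm w)

theorem continuous_pairing (w : HSpace m) : Continuous fun q : HSpace m => pairing q w :=
  continuous_finsetSum _ fun l _ => (continuous_apply l).inner continuous_const

theorem integrable_bumpMul (hF : IsRegularOn F (siegelHalfSpace m))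
    (hx : Metric.ball x r ⊆ siegelHalfSpace m) (hτ : |τ| < r) {a : RealCoord m → ℝ}
    (ha : Continuous a) : Integrable fun y => a y • bumpMul F x τ y := by
  refine integrable_of_continuousOn_of_isCompact isCompact_unitBall
    (ha.continuousOn.smul (((continuous_bump.comp (coordEquiv m).continuous).continuousOn).smul
      (continuousOn_translate hF.1.continuousOn hx hτ))) fun y hy => ?_
  rw [bumpMul, bump_eq_zero (not_le.1 hy)]
  simp

theorem integrable_slope_smul (hF : IsRegularOn F (siegelHalfSpace m))
    (hx : Metric.ball x r ⊆ siegelHalfSpace m) (hτ : |τ| < r) {a : RealCoord m → ℝ}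
    (ha : Continuous a) :
    Integrable fun y => (bumpSlope (coordEquiv m y) * a y) • F (x + τ • coordEquiv m y) := by
  refine integrable_of_continuousOn_of_isCompact isCompact_unitBall
    ((((continuous_bumpSlope.comp (coordEquiv m).continuous).mul ha).continuousOn).smul
      (continuousOn_translate hF.1.continuousOn hx hτ)) fun y hy => ?_
  rw [bumpSlope_eq_zero (not_le.1 hy)]
  simp

theorem integrable_bump_smul_fderiv (hF : IsRegularOn F (siegelHalfSpace m))
    (hx : Metric.ball x r ⊆ siegelHalfSpace m) (hτ : |τ| < r) (w : HSpace m)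
    {a : RealCoord m → ℝ} (ha : Continuous a) :
    Integrable fun y => (bump (coordEquiv m y) * a y) •
      fderiv ℝ F (x + τ • coordEquiv m y) w := by
  refine integrable_of_continuousOn_of_isCompact isCompact_unitBall
    ((((continuous_bump.comp (coordEquiv m).continuous).mul ha).continuousOn).smul
      (continuousOn_translate (hF.continuousOn_fderiv_apply w) hx hτ)) fun y hy => ?_
  rw [bump_eq_zero (not_le.1 hy)]
  simp

theorem continuous_coord_pairing (w : HSpace m) :
    Continuous fun y : RealCoord m => pairing (coordEquiv m y) w :=
  (continuous_pairing w).comp (coordEquiv m).continuous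

/-- Integration by parts against a linear weight. -/
theorem smul_integral_bump_smul_fderiv (hF : IsRegularOn F (siegelHalfSpace m))
    (hx : Metric.ball x r ⊆ siegelHalfSpace m) (hτ : |τ| < r) (v w : HSpace m) :
    τ • ∫ y, (bump (coordEquiv m y) * pairing (coordEquiv m y) v) •
        fderiv ℝ F (x + τ • coordEquiv m y) w
      = -(pairing w v • ∫ y, bumpMul F x τ y)
        - ∫ y, (bumpSlope (coordEquiv m y) *
          (pairing (coordEquiv m y) v * pairing (coordEquiv m y) w)) •
            F (x + τ • coordEquiv m y) := by
  have hv := continuous_coord_pairing (m := m) v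
  have hw := continuous_coord_pairing (m := m) w
  have i1 : Integrable fun y => pairing w v • bumpMul F x τ y :=
    integrable_bumpMul hF hx hτ continuous_const
  have i2 : Integrable fun y => (bumpSlope (coordEquiv m y) *
      (pairing (coordEquiv m y) v * pairing (coordEquiv m y) w)) • F (x + τ • coordEquiv m y) :=
    integrable_slope_smul hF hx hτ (hv.mul hw)
  have i3 : Integrable fun y => τ • (bump (coordEquiv m y) * pairing (coordEquiv m y) v) •
      fderiv ℝ F (x + τ • coordEquiv m y) w :=
    (integrable_bump_smul_fderiv hF hx hτ w hv).smul τ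
  -- The derivative in direction w of ⟨y, v⟩ bump(y) F(x + τy) has three terms, from the linear
  -- weight, the bump and F. The first two are symmetric in v and w.
  have h := integral_eq_zero_of_hasLineDerivAt (v := (coordEquiv m).symm w)
    (integrable_bumpMul hF hx hτ hv) ((i1.add i2).add i3) (by
      intro y
      have h1 : HasLineDerivAt ℝ (fun y => pairing (coordEquiv m y) v) (pairing w v) y
          ((coordEquiv m).symm w) := by
        rw [HasLineDerivAt]
        have e : (fun s : ℝ => pairing (coordEquiv m (y + s • (coordEquiv m).symm w)) v)
            = fun s : ℝ => pairing (coordEquiv m y) v + s * pairing w v := by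
          funext s
          simp [pairing, inner_add_left, real_inner_smul_left, Finset.sum_add_distrib,
            Finset.mul_sum]
        rw [e]
        simpa using ((hasDerivAt_id (0 : ℝ)).mul_const (pairing w v)).const_add
          (pairing (coordEquiv m y) v)
      have h2 := hasLineDerivAt_bumpMul hF hx hτ w y
      rw [HasLineDerivAt] at h1 h2 ⊢
      refine (h1.smul h2).congr_deriv ?_
      simp only [Pi.add_apply, bumpMulDeriv, bumpMul, zero_smul, add_zero]
      module)
  rw [integral_add' (i1.add i2) i3, integral_add' i1 i2, integral_smul, integral_smul] at h
  rw [eq_sub_iff_add_eq, eq_neg_iff_add_eq_zero, ← h]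
  abel

end

end

/-! ### Symmetric moments and the mean value formula -/

noncomputable section

variable {m : ℕ} {F : HSpace m → ℍ[ℝ]}

/-- The basis `1, i, j, k` of the quaternions. -/
def quatUnit : Fin 4 → ℍ[ℝ] := ![1, quat 0 1 0 0, quat 0 0 1 0, quat 0 0 0 1]

theorem cauchyFueter_eq_sum_quatUnit (l : Fin (m + 1)) (F : HSpace m → ℍ[ℝ]) (q : HSpace m) :
    cauchyFueter l F q = ∑ b, quatUnit b * fderiv ℝ F q (Pi.single l (quatUnit b)) := by
  simp [cauchyFueter, Fin.sum_univ_four, quatUnit]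

theorem sum_inner_quatUnit_smul (q : ℍ[ℝ]) : ∑ a, (inner ℝ q (quatUnit a) : ℝ) • quatUnit a = q := by
  ext <;> simp [Fin.sum_univ_four, quatUnit, Quaternion.inner_def]

/-- For a ≠ b the product star e_a * e_b is antisymmetric in (a, b) and cancels against J. On the
diagonal it equals 1. -/
theorem sum_star_mul_mul_of_symm {J : Fin 4 → Fin 4 → ℍ[ℝ]} (hJ : ∀ a b, J a b = J b a) :
    ∑ a, ∑ b, star (quatUnit a) * quatUnit b * J a b = ∑ a, J a a := by
  simp only [Fin.sum_univ_four]
  rw [hJ 1 0, hJ 2 0, hJ 3 0, hJ 2 1, hJ 3 1, hJ 3 2]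
  ext <;> simp [quatUnit] <;> ring

theorem pairing_single (q : HSpace m) (l : Fin (m + 1)) (e : ℍ[ℝ]) :
    pairing q (Pi.single l e) = inner ℝ (q l) e := by
  rw [pairing, Finset.sum_eq_single l]
  · simp
  · intro k _ hk
    simp [Pi.single_eq_of_ne hk]
  · simp

theorem sum_pairing_smul_single (q : HSpace m) :
    ∑ l, ∑ a, pairing q (Pi.single l (quatUnit a)) • (Pi.single l (quatUnit a) : HSpace m) = q := by
  conv_rhs => rw [← Finset.univ_sum_single q]
  refine Finset.sum_congr rfl fun l _ => ?_
  conv_rhs => rw [← sum_inner_quatUnit_smul (q l)]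
  simp only [pairing_single, ← Pi.single_smul]
  exact (map_sum (AddMonoidHom.single (fun _ : Fin (m + 1) => ℍ[ℝ]) l) _ _).symm

variable {x : HSpace m} {r τ : ℝ}

/-- After integration by parts the expression is symmetric in v and w, and τ ≠ 0 can be cancelled.
This replaces the symmetry of second derivatives, which a C¹ function need not have. -/
theorem integral_bump_smul_fderiv_symm (hF : IsRegularOn F (siegelHalfSpace m))
    (hx : Metric.ball x r ⊆ siegelHalfSpace m) (hτ : |τ| < r) (hτ0 : τ ≠ 0) (v w : HSpace m) :
    ∫ y, (bump (coordEquiv m y) * pairing (coordEquiv m y) v) •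
        fderiv ℝ F (x + τ • coordEquiv m y) w
      = ∫ y, (bump (coordEquiv m y) * pairing (coordEquiv m y) w) •
        fderiv ℝ F (x + τ • coordEquiv m y) v := by
  refine smul_right_injective _ hτ0 ?_
  simp only
  rw [smul_integral_bump_smul_fderiv hF hx hτ, smul_integral_bump_smul_fderiv hF hx hτ]
  have e : pairing w v = pairing v w :=
    Finset.sum_congr rfl fun l _ => real_inner_comm _ _
  simp only [e, mul_comm (pairing _ v)]

/-- By moment symmetry the trace equals the double sum weighted by star e_a * e_b, whose integrand
contains the Cauchy–Fueter operator applied to F. It is a weak form of the factorization of the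
Laplacian. -/
theorem sum_integral_bump_smul_fderiv_eq_zero (hF : IsRegularOn F (siegelHalfSpace m))
    (hx : Metric.ball x r ⊆ siegelHalfSpace m) (hτ : |τ| < r) (hτ0 : τ ≠ 0) (l : Fin (m + 1)) :
    ∑ a, ∫ y, (bump (coordEquiv m y) *
        pairing (coordEquiv m y) (Pi.single l (quatUnit a))) •
          fderiv ℝ F (x + τ • coordEquiv m y) (Pi.single l (quatUnit a)) = 0 := by
  have hint : ∀ a b, Integrable fun y => (bump (coordEquiv m y) *
      pairing (coordEquiv m y) (Pi.single l (quatUnit a))) •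
        fderiv ℝ F (x + τ • coordEquiv m y) (Pi.single l (quatUnit b)) := fun a b =>
    integrable_bump_smul_fderiv hF hx hτ _ (continuous_coord_pairing _)
  rw [← sum_star_mul_mul_of_symm (J := fun a b => ∫ y, (bump (coordEquiv m y) *
      pairing (coordEquiv m y) (Pi.single l (quatUnit a))) •
        fderiv ℝ F (x + τ • coordEquiv m y) (Pi.single l (quatUnit b)))
    (fun a b => integral_bump_smul_fderiv_symm hF hx hτ hτ0 _ _)]
  have h1 : ∀ a b, star (quatUnit a) * quatUnit b * (∫ y, (bump (coordEquiv m y) *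
      pairing (coordEquiv m y) (Pi.single l (quatUnit a))) •
        fderiv ℝ F (x + τ • coordEquiv m y) (Pi.single l (quatUnit b)))
      = ∫ y, star (quatUnit a) * quatUnit b * ((bump (coordEquiv m y) *
      pairing (coordEquiv m y) (Pi.single l (quatUnit a))) •
        fderiv ℝ F (x + τ • coordEquiv m y) (Pi.single l (quatUnit b))) := fun a b =>
    (integral_const_mul_of_integrable (hint a b)).symm
  simp only [h1]
  simp only [← integral_finsetSum _ fun b _ => (hint _ b).const_mul _]
  rw [← integral_finsetSum _ fun a _ => integrable_finsetSum _ fun b _ => (hint a b).const_mul _]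
  refine integral_eq_zero_of_ae (Eventually.of_forall fun y => ?_)
  by_cases hy : y ∈ unitBall m
  · have h0 := hF.2 _ (translate_mem hx hτ hy) l
    rw [cauchyFueter_eq_sum_quatUnit] at h0
    have h2 : ∀ a, ∑ b, star (quatUnit a) * quatUnit b * ((bump (coordEquiv m y) *
      pairing (coordEquiv m y) (Pi.single l (quatUnit a))) •
        fderiv ℝ F (x + τ • coordEquiv m y) (Pi.single l (quatUnit b)))
        = (bump (coordEquiv m y) * pairing (coordEquiv m y) (Pi.single l (quatUnit a))) •
          (star (quatUnit a) * ∑ b, quatUnit b *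
            fderiv ℝ F (x + τ • coordEquiv m y) (Pi.single l (quatUnit b))) := by
      intro a
      rw [Finset.mul_sum, Finset.smul_sum]
      exact Finset.sum_congr rfl fun b _ => by rw [mul_smul_comm, mul_assoc]
    simp only [h2, h0, mul_zero, smul_zero, Finset.sum_const_zero, Pi.zero_apply]
  · simp [bump_eq_zero (not_le.1 hy)]

/-- The radial derivative of a regular function has vanishing radial averages. -/
theorem integral_bump_smul_radial_fderiv (hF : IsRegularOn F (siegelHalfSpace m))
    (hx : Metric.ball x r ⊆ siegelHalfSpace m) (hτ : |τ| < r) :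
    ∫ y, bump (coordEquiv m y) • fderiv ℝ F (x + τ • coordEquiv m y) (coordEquiv m y) = 0 := by
  rcases eq_or_ne τ 0 with rfl | hτ0
  -- At τ = 0 there is no factor to cancel, but the integrand is odd in y: the bump is even and the
  -- derivative at x is linear.
  · have h := Measure.integral_comp_smul volume (fun y : RealCoord m =>
      bump (coordEquiv m y) • fderiv ℝ F (x + (0 : ℝ) • coordEquiv m y) (coordEquiv m y)) (-1)
    have e : ∀ q : HSpace m, bump (-q) = bump q := fun q => by simp [bump, totalNormSq]
    simp only [neg_smul, one_smul, map_neg, e, zero_smul, neg_zero, add_zero, smul_neg,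
      integral_neg, abs_inv, abs_pow, abs_neg, abs_one, one_pow, inv_one] at h ⊢
    have h2 := add_eq_zero_iff_eq_neg.2 h.symm
    rwa [← two_smul ℝ, smul_eq_zero_iff_right two_ne_zero] at h2
  · have hint : ∀ l a, Integrable fun y => (bump (coordEquiv m y) *
        pairing (coordEquiv m y) (Pi.single l (quatUnit a))) •
          fderiv ℝ F (x + τ • coordEquiv m y) (Pi.single l (quatUnit a)) := fun l a =>
      integrable_bump_smul_fderiv hF hx hτ _ (continuous_coord_pairing _)
    have e : ∀ y, bump (coordEquiv m y) •
        fderiv ℝ F (x + τ • coordEquiv m y) (coordEquiv m y)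
        = ∑ l, ∑ a, (bump (coordEquiv m y) *
          pairing (coordEquiv m y) (Pi.single l (quatUnit a))) •
            fderiv ℝ F (x + τ • coordEquiv m y) (Pi.single l (quatUnit a)) := by
      intro y
      generalize fderiv ℝ F (x + τ • coordEquiv m y) = L
      have hL := congrArg L (sum_pairing_smul_single (coordEquiv m y))
      simp only [map_sum, map_smul] at hL
      simp only [← hL, Finset.smul_sum, smul_smul]
    simp only [e]
    rw [integral_finsetSum _ fun l _ => integrable_finsetSum _ fun a _ => hint l a]
    refine Finset.sum_eq_zero fun l _ => ?_
    rw [integral_finsetSum _ fun a _ => hint l a]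
    exact sum_integral_bump_smul_fderiv_eq_zero hF hx hτ hτ0 l

theorem setIntegral_unitBall {E : Type*} [NormedAddCommGroup E] [NormedSpace ℝ E]
    (g : RealCoord m → E) :
    ∫ y in unitBall m, bump (coordEquiv m y) • g y = ∫ y, bump (coordEquiv m y) • g y :=
  setIntegral_eq_integral_of_forall_compl_eq_zero fun y hy => by
    rw [bump_eq_zero (not_le.1 hy), zero_smul]

/-- The mean value property of regular functions. -/
theorem IsRegularOn.mean_value (hF : IsRegularOn F (siegelHalfSpace m))
    (hx : Metric.ball x r ⊆ siegelHalfSpace m) (hτ : |τ| < r) :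
    ∫ y, bump (coordEquiv m y) • F (x + τ • coordEquiv m y) = bumpMass m • F x := by
  have hr : 0 < r := (abs_nonneg τ).trans_lt hτ
  have hcoord : Continuous fun p : ℝ × RealCoord m => coordEquiv m p.2 :=
    (coordEquiv m).continuous.comp continuous_snd
  have htrans : Continuous fun p : ℝ × RealCoord m => x + p.1 • coordEquiv m p.2 :=
    continuous_const.add (continuous_fst.smul hcoord)
  have hmaps : Set.MapsTo (fun p : ℝ × RealCoord m => x + p.1 • coordEquiv m p.2)
      (Set.Ioo (-r) r ×ˢ unitBall m) (siegelHalfSpace m) := fun p hp =>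
    translate_mem hx (abs_lt.2 hp.1) hp.2
  have hbump : Continuous fun p : ℝ × RealCoord m => bump (coordEquiv m p.2) :=
    continuous_bump.comp hcoord
  -- The derivative of the average in the dilation σ is the average of the radial derivative, hence
  -- 0. The average keeps its value at σ = 0.
  have hderiv : ∀ σ ∈ Set.Ioo (-r) r, HasDerivAt
      (fun σ : ℝ => ∫ y in unitBall m, bump (coordEquiv m y) • F (x + σ • coordEquiv m y)) 0 σ := by
    intro σ hσ
    have h := hasDerivAt_setIntegral_of_isCompact (μ := volume)
      (f := fun (σ : ℝ) y => bump (coordEquiv m y) • F (x + σ • coordEquiv m y))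
      (f' := fun (σ : ℝ) y => bump (coordEquiv m y) •
        fderiv ℝ F (x + σ • coordEquiv m y) (coordEquiv m y))
      isCompact_unitBall isOpen_Ioo
      (hbump.continuousOn.smul (hF.1.continuousOn.comp htrans.continuousOn hmaps))
      (hbump.continuousOn.smul (((hF.1.continuousOn_fderiv_of_isOpen isOpen_siegelHalfSpace
        le_rfl).comp htrans.continuousOn hmaps).clm_apply hcoord.continuousOn))
      (fun σ hσ y hy => by
        have h1 := hF.hasFDerivAt (translate_mem hx (abs_lt.2 hσ) hy)
        have h2 : HasDerivAt (fun σ : ℝ => x + σ • coordEquiv m y) (coordEquiv m y) σ := by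
          simpa using ((hasDerivAt_id σ).smul_const (coordEquiv m y)).const_add x
        exact (h1.comp_hasDerivAt σ h2).const_smul (bump (coordEquiv m y))) hσ
    rwa [setIntegral_unitBall, integral_bump_smul_radial_fderiv hF hx (abs_lt.2 hσ)] at h
  have h := (convex_Ioo (-r) r).norm_image_sub_le_of_norm_hasDerivWithin_le (C := 0)
    (fun σ hσ => (hderiv σ hσ).hasDerivWithinAt) (fun _ _ => by simp)
    (show (0 : ℝ) ∈ Set.Ioo (-r) r by simp [hr]) (abs_lt.1 hτ)
  rw [zero_mul, norm_le_zero_iff, sub_eq_zero, setIntegral_unitBall, setIntegral_unitBall] at h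
  rw [h]
  simp only [zero_smul, add_zero]
  rw [integral_smul_const, bumpMass]

/-- The derivative of a regular function, expressed through its values. -/
theorem IsRegularOn.smul_fderiv_eq (hF : IsRegularOn F (siegelHalfSpace m))
    (hx : Metric.ball x r ⊆ siegelHalfSpace m) (hτ : |τ| < r) (w : HSpace m) :
    (τ * bumpMass m) • fderiv ℝ F x w
      = -∫ y, (bumpSlope (coordEquiv m y) * pairing (coordEquiv m y) w) •
          F (x + τ • coordEquiv m y) := by
  -- For these θ the centre x + θw still has room for a dilation by τ inside the original ball.
  set s : Set ℝ := {θ | ‖θ • w‖ < r - |τ|} with hs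
  have hso : IsOpen s := isOpen_lt (by fun_prop) continuous_const
  have h0 : (0 : ℝ) ∈ s := by simp [hs, hτ]
  have hball : ∀ θ ∈ s, Metric.ball (x + θ • w) (r - ‖θ • w‖) ⊆ siegelHalfSpace m := by
    intro θ _
    refine (Metric.ball_subset_ball' ?_).trans hx
    rw [dist_self_add_left]
    linarith
  have hlt : ∀ θ ∈ s, |τ| < r - ‖θ • w‖ := fun θ hθ => by
    have : ‖θ • w‖ < r - |τ| := hθ
    linarith
  have hcoord : Continuous fun p : ℝ × RealCoord m => coordEquiv m p.2 :=
    (coordEquiv m).continuous.comp continuous_snd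
  have htrans : Continuous fun p : ℝ × RealCoord m => x + p.1 • w + τ • coordEquiv m p.2 :=
    (continuous_const.add (continuous_fst.smul continuous_const)).add (hcoord.const_smul τ)
  have hmaps : Set.MapsTo (fun p : ℝ × RealCoord m => x + p.1 • w + τ • coordEquiv m p.2)
      (s ×ˢ unitBall m) (siegelHalfSpace m) := fun p hp =>
    translate_mem (hball _ hp.1) (hlt _ hp.1) hp.2
  have hbump : Continuous fun p : ℝ × RealCoord m => bump (coordEquiv m p.2) :=
    continuous_bump.comp hcoord
  have h := hasDerivAt_setIntegral_of_isCompact (μ := volume)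
    (f := fun (θ : ℝ) y => bump (coordEquiv m y) • F (x + θ • w + τ • coordEquiv m y))
    (f' := fun (θ : ℝ) y => bump (coordEquiv m y) •
      fderiv ℝ F (x + θ • w + τ • coordEquiv m y) w)
    isCompact_unitBall hso
    (hbump.continuousOn.smul (hF.1.continuousOn.comp htrans.continuousOn hmaps))
    (hbump.continuousOn.smul ((hF.continuousOn_fderiv_apply w).comp htrans.continuousOn hmaps))
    (fun θ hθ y hy => by
      have h1 := hF.hasFDerivAt (translate_mem (hball _ hθ) (hlt _ hθ) hy)
      have h2 : HasDerivAt (fun θ : ℝ => x + θ • w + τ • coordEquiv m y) w θ := by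
        simpa using (((hasDerivAt_id θ).smul_const w).const_add x).add_const
          (τ • coordEquiv m y)
      exact (h1.comp_hasDerivAt θ h2).const_smul (bump (coordEquiv m y))) h0
  have h' : HasDerivAt (fun θ : ℝ => bumpMass m • F (x + θ • w))
      (bumpMass m • fderiv ℝ F x w) 0 := by
    have hxU : x ∈ siegelHalfSpace m := hx (Metric.mem_ball_self ((abs_nonneg τ).trans_lt hτ))
    exact ((hF.hasFDerivAt hxU).hasLineDerivAt w).const_smul (bumpMass m)
  have heq : (fun θ : ℝ => ∫ y in unitBall m, bump (coordEquiv m y) •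
      F (x + θ • w + τ • coordEquiv m y)) =ᶠ[𝓝 0] fun θ => bumpMass m • F (x + θ • w) := by
    filter_upwards [hso.mem_nhds h0] with θ hθ
    rw [setIntegral_unitBall, hF.mean_value (hball _ hθ) (hlt _ hθ)]
  -- The mean value formula is differentiated in its centre. A further integration by parts moves
  -- the derivative onto the bump, with a factor τ from the chain rule.
  have huniq := (h'.congr_of_eventuallyEq heq).unique h
  rw [setIntegral_unitBall] at huniq
  simp only [zero_smul, add_zero] at huniq
  rw [mul_smul, huniq]
  have i1 := integrable_slope_smul hF hx hτ (continuous_coord_pairing w)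
  have i2 := integrable_bump_smul_fderiv hF hx hτ w (a := fun _ => τ) continuous_const
  have i0 := integrable_bumpMul hF hx hτ (a := fun _ => 1) continuous_const
  simp only [one_smul] at i0
  have hz := integral_eq_zero_of_hasLineDerivAt i0 (i1.add i2)
    (fun y => hasLineDerivAt_bumpMul hF hx hτ w y)
  rw [integral_add' i1 i2] at hz
  rw [eq_neg_iff_add_eq_zero, ← hz, add_comm, ← integral_smul]
  simp only [smul_smul, mul_comm τ]

end

noncomputable section

variable {m : ℕ} {F : HSpace m → ℍ[ℝ]}

/-! ### Interior estimates -/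

/-- The defining function `Re q₁ - |q'|²` of the Siegel half space. -/
def height (q : HSpace m) : ℝ := (q 0).re - tailNormSq q

theorem continuous_height : Continuous (height : HSpace m → ℝ) :=
  (Quaternion.continuous_re.comp (continuous_apply 0)).sub
    (continuous_finsetSum _ fun l _ => ((continuous_apply l.succ).norm.pow 2))

theorem height_pos_iff {q : HSpace m} : 0 < height q ↔ q ∈ siegelHalfSpace m := sub_pos

theorem height_slicePoint (t : ℝ) (p : Heisenberg m) : height (slicePoint t p) = t := by
  have h : (((boundaryProjection m).symm p).1 0).re
      = tailNormSq ((boundaryProjection m).symm p).1 := ((boundaryProjection m).symm p).2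
  simp only [height, slicePoint, tailNormSq_add_single, Pi.add_apply, Pi.single_eq_same,
    Quaternion.re_add, Quaternion.re_coe, h]
  ring

theorem coordEquiv_add_tailNormSq (t : ℝ) (p : Heisenberg m) :
    coordEquiv m (t + tailNormSq ((boundaryProjection m).symm p).1, p) = slicePoint t p := by
  have h0 : ∀ x : RealCoord m, coordEquiv m x = Fin.cons (quat x.1 (x.2.1 0) (x.2.1 1) (x.2.1 2))
    (fun l => quat (x.2.2 l 0) (x.2.2 l 1) (x.2.2 l 2) (x.2.2 l 3)) := fun _ => rfl
  rw [h0]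
  funext l
  refine Fin.cases ?_ (fun i => ?_) l
  · ext <;> simp [slicePoint, boundaryProjection, tailNormSq, add_comm]
  · simp [slicePoint, boundaryProjection]

/-- By Tonelli, the integral over a set with heights in (a, b) is at most an integral of slice
integrals. Each slice contributes at most `hardySup F`, over an interval of length b - a. -/
theorem lintegral_indicator_slice_le (hF : ContinuousOn F (siegelHalfSpace m)) {S : Set (HSpace m)}
    (hS : IsClosed S) {a b : ℝ} (ha : 0 < a) (hSab : ∀ q ∈ S, height q ∈ Set.Ioo a b) :
    ∫⁻ z, S.indicator (fun q => ‖F q‖ₑ ^ 2) (coordEquiv m z)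
      ≤ ENNReal.ofReal (b - a) * hardySup F := by
  have hFn : ContinuousOn (fun q => ‖F q‖ₑ ^ 2) (siegelHalfSpace m) :=
    (ENNReal.continuous_pow 2).comp_continuousOn (continuous_enorm.comp_continuousOn hF)
  have hSU : S ⊆ siegelHalfSpace m := fun q hq => height_pos_iff.1 (ha.trans (hSab q hq).1)
  have hpre : MeasurableSet (coordEquiv m ⁻¹' S) :=
    (hS.preimage (coordEquiv m).continuous).measurableSet
  have hmeas : AEMeasurable (fun z => S.indicator (fun q => ‖F q‖ₑ ^ 2) (coordEquiv m z))
      (volume : Measure (RealCoord m)) := by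
    have e : (fun z => S.indicator (fun q => ‖F q‖ₑ ^ 2) (coordEquiv m z))
        = (coordEquiv m ⁻¹' S).indicator fun z => ‖F (coordEquiv m z)‖ₑ ^ 2 := rfl
    rw [e, aemeasurable_indicator_iff hpre]
    exact (hFn.comp (coordEquiv m).continuous.continuousOn fun z hz => hSU hz).aemeasurable hpre
  have hT : MeasurableSet (Set.Ioo a b ×ˢ (Set.univ : Set (Heisenberg m))) :=
    (isOpen_Ioo.prod isOpen_univ).measurableSet
  set g : ℝ → Heisenberg m → ℝ≥0∞ := fun t p =>
    (Set.Ioo a b ×ˢ (Set.univ : Set (Heisenberg m))).indicator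
      (fun x => ‖F (slicePoint x.1 x.2)‖ₑ ^ 2) (t, p) with hg
  have hgmeas : AEMeasurable (Function.uncurry g)
      ((volume : Measure ℝ).prod (volume : Measure (Heisenberg m))) := by
    have e : Function.uncurry g = (Set.Ioo a b ×ˢ (Set.univ : Set (Heisenberg m))).indicator
      (fun x => ‖F (slicePoint x.1 x.2)‖ₑ ^ 2) := rfl
    rw [e, aemeasurable_indicator_iff hT]
    refine ContinuousOn.aemeasurable ?_ hT
    rw [continuousOn_iff_continuous_domRestrict]
    exact continuous_comp_slicePoint
      (t := fun x : (Set.Ioo a b ×ˢ (Set.univ : Set (Heisenberg m)) : Set _) => x.1.1)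
      (p := fun x => x.1.2) hFn (by fun_prop) (by fun_prop) fun x => ha.trans x.2.1.1
  calc ∫⁻ z, S.indicator (fun q => ‖F q‖ₑ ^ 2) (coordEquiv m z)
      = ∫⁻ p, ∫⁻ t, S.indicator (fun q => ‖F q‖ₑ ^ 2) (coordEquiv m (t, p)) :=
        lintegral_prod_symm _ hmeas
    _ = ∫⁻ p, ∫⁻ t, S.indicator (fun q => ‖F q‖ₑ ^ 2) (slicePoint t p) := by
        refine lintegral_congr fun p => ?_
        -- For fixed p, translating the real coordinate by |q'|² turns it into the height and
        -- preserves the measure.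
        rw [← lintegral_add_right_eq_self _ (tailNormSq ((boundaryProjection m).symm p).1)]
        simp only [coordEquiv_add_tailNormSq]
    _ ≤ ∫⁻ p, ∫⁻ t, g t p := by
        refine lintegral_mono fun p => lintegral_mono fun t => ?_
        by_cases ht : slicePoint t p ∈ S
        · have h := hSab _ ht
          rw [height_slicePoint] at h
          simp only [hg]
          rw [Set.indicator_of_mem ht, Set.indicator_of_mem (by exact ⟨h, trivial⟩)]
        · rw [Set.indicator_of_notMem ht]
          exact zero_le
    _ = ∫⁻ t, ∫⁻ p, g t p := (lintegral_lintegral_swap hgmeas).symm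
    _ ≤ ∫⁻ t, (Set.Ioo a b).indicator (fun _ => hardySup F) t := by
        refine lintegral_mono fun t => ?_
        by_cases ht : t ∈ Set.Ioo a b
        · have h := lintegral_le_hardySup F (ha.trans ht.1)
          rw [lintegral_boundaryMeasure] at h
          rw [Set.indicator_of_mem ht]
          refine le_trans (lintegral_mono fun p => ?_) h
          exact Set.indicator_le_self _ _ _
        · have h0 : ∀ p, g t p = 0 := fun p =>
            Set.indicator_of_notMem (fun hx => ht hx.1) _
          simp [h0]
    _ = ENNReal.ofReal (b - a) * hardySup F := by
        rw [lintegral_indicator measurableSet_Ioo, lintegral_const, Measure.restrict_apply_univ,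
          Real.volume_Ioo, mul_comm]

theorem lintegral_comp_add_smul (g : RealCoord m → ℝ≥0∞) (x : RealCoord m) {τ : ℝ} (hτ : τ ≠ 0) :
    ∫⁻ y, g (x + τ • y)
      = ENNReal.ofReal |(τ ^ Module.finrank ℝ (RealCoord m))⁻¹| * ∫⁻ y, g y := by
  have h := (Homeomorph.smulOfNeZero τ hτ).measurableEmbedding.lintegral_map
    (μ := (volume : Measure (RealCoord m))) (fun y => g (x + y))
  have h2 := Measure.map_addHaar_smul (volume : Measure (RealCoord m)) hτ
  have e : ⇑(Homeomorph.smulOfNeZero τ hτ : RealCoord m ≃ₜ RealCoord m) = (τ • ·) := rfl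
  rw [e, h2, lintegral_smul_measure, lintegral_add_left_eq_self] at h
  exact h.symm

theorem lintegral_sq_le_measure_mul {α E : Type*} [MeasurableSpace α] [NormedAddCommGroup E]
    {μ : Measure α} {f : α → E} (hf : AEStronglyMeasurable f μ) :
    (∫⁻ y, ‖f y‖ₑ ∂μ) ^ 2 ≤ (∫⁻ y, ‖f y‖ₑ ^ 2 ∂μ) * μ Set.univ := by
  have h := eLpNorm_le_eLpNorm_mul_rpow_measure_univ (one_le_two (α := ℝ≥0∞)) hf
  rw [eLpNorm_one_eq_lintegral_enorm] at h
  refine (pow_le_pow_left₀ zero_le h 2).trans (le_of_eq ?_)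
  rw [mul_pow, eLpNorm_two_sq, ← ENNReal.rpow_natCast, ← ENNReal.rpow_mul]
  norm_num

/-- Point evaluations are bounded on the Hardy space, uniformly near interior points. -/
theorem exists_norm_le_hardyNorm {τ a b : ℝ} (hτ : 0 < τ) (ha : 0 < a) :
    ∃ C : ℝ, 0 ≤ C ∧ ∀ F : HSpace m → ℍ[ℝ], MemHardy F → ∀ (x : HSpace m) (r : ℝ), τ < r →
      Metric.ball x r ⊆ siegelHalfSpace m →
      (∀ q ∈ Metric.closedBall x τ, height q ∈ Set.Ioo a b) → ‖F x‖ ≤ C * hardyNorm F := by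
  -- The factors are the Jacobian of y ↦ x + τy, the thickness of the layer of heights, and the
  -- volume coming from Cauchy–Schwarz.
  set D : ℝ≥0∞ := ENNReal.ofReal |(τ ^ Module.finrank ℝ (RealCoord m))⁻¹| *
    ENNReal.ofReal (b - a) * volume (unitBall m) with hD
  have hDtop : D ≠ ∞ := ENNReal.mul_ne_top (by finiteness) isCompact_unitBall.measure_lt_top.ne
  refine ⟨√D.toReal / bumpMass m, div_nonneg (Real.sqrt_nonneg _) bumpMass_pos.le,
    fun F hF x r hr hx hab => ?_⟩
  have hτr : |τ| < r := by rwa [abs_of_pos hτ]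
  have h1 : ‖bumpMass m • F x‖ₑ ≤ ∫⁻ y in unitBall m, ‖F (x + τ • coordEquiv m y)‖ₑ := by
    rw [← hF.1.mean_value hx hτr, ← setIntegral_unitBall]
    refine (enorm_integral_le_lintegral_enorm _).trans (lintegral_mono fun y => ?_)
    rw [enorm_smul]
    refine mul_le_of_le_one_left zero_le ?_
    rw [Real.enorm_of_nonneg (bump_nonneg _)]
    exact ENNReal.ofReal_le_one.2 (bump_le_one _)
  have h2 : ∫⁻ y in unitBall m, ‖F (x + τ • coordEquiv m y)‖ₑ ^ 2
      ≤ ENNReal.ofReal |(τ ^ Module.finrank ℝ (RealCoord m))⁻¹| *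
        (ENNReal.ofReal (b - a) * hardySup F) := by
    refine le_trans ?_ (mul_le_mul_right (lintegral_indicator_slice_le hF.1.1.continuousOn
      Metric.isClosed_closedBall ha hab) _)
    rw [← lintegral_comp_add_smul (fun z => (Metric.closedBall x τ).indicator
      (fun q => ‖F q‖ₑ ^ 2) (coordEquiv m z)) ((coordEquiv m).symm x) hτ.ne',
      ← lintegral_indicator isCompact_unitBall.measurableSet]
    refine lintegral_mono fun y => ?_
    by_cases hy : y ∈ unitBall m
    · rw [Set.indicator_of_mem hy, map_add, map_smul, ContinuousLinearEquiv.apply_symm_apply,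
        Set.indicator_of_mem]
      rw [mem_closedBall_iff_norm, add_sub_cancel_left, norm_smul, Real.norm_of_nonneg hτ.le]
      exact mul_le_of_le_one_right hτ.le (norm_le_of_totalNormSq_le hy)
    · rw [Set.indicator_of_notMem hy]
      exact zero_le
  have h3 : ‖bumpMass m • F x‖ₑ ^ 2 ≤ D * hardySup F := by
    have hm : AEStronglyMeasurable (fun y => F (x + τ • coordEquiv m y))
        (volume.restrict (unitBall m)) :=
      (continuousOn_translate hF.1.1.continuousOn hx hτr).aestronglyMeasurable_of_isCompact
        isCompact_unitBall isCompact_unitBall.measurableSet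
    refine (pow_le_pow_left₀ zero_le h1 2).trans ((lintegral_sq_le_measure_mul hm).trans ?_)
    rw [Measure.restrict_apply_univ]
    refine (mul_le_mul_left h2 _).trans (le_of_eq ?_)
    rw [hD]
    ring
  have h4 := ENNReal.toReal_mono (ENNReal.mul_ne_top hDtop hF.2.ne) h3
  rw [ENNReal.toReal_pow, toReal_enorm, ENNReal.toReal_mul, norm_smul,
    Real.norm_of_nonneg bumpMass_pos.le] at h4
  have h5 := Real.le_sqrt_of_sq_le h4
  rw [Real.sqrt_mul ENNReal.toReal_nonneg] at h5
  rw [div_mul_eq_mul_div, le_div_iff₀ bumpMass_pos, mul_comm]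
  exact h5

/-- The norm on `HSpace` is the supremum norm, so each of the m + 1 coordinates contributes one
term. -/
theorem abs_pairing_le (q w : HSpace m) : |pairing q w| ≤ (m + 1) * (‖q‖ * ‖w‖) := by
  refine (Finset.abs_sum_le_sum_abs _ _).trans ((Finset.sum_le_sum fun l _ =>
    (abs_real_inner_le_norm _ _).trans
      (mul_le_mul (norm_le_pi_norm q l) (norm_le_pi_norm w l) (norm_nonneg _)
        (norm_nonneg _))).trans (le_of_eq ?_))
  simp

/-- A Cauchy estimate for regular functions. -/
theorem exists_norm_fderiv_le {τ : ℝ} (hτ : 0 < τ) :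
    ∃ C : ℝ, 0 ≤ C ∧ ∀ F : HSpace m → ℍ[ℝ], IsRegularOn F (siegelHalfSpace m) →
      ∀ (x : HSpace m) (r A : ℝ), τ < r → Metric.ball x r ⊆ siegelHalfSpace m →
      (∀ q ∈ Metric.closedBall x τ, ‖F q‖ ≤ A) → ‖fderiv ℝ F x‖ ≤ C * A := by
  obtain ⟨K, hK⟩ := (isCompact_unitBall (m := m)).exists_bound_of_continuousOn
    (f := fun y => bumpSlope (coordEquiv m y))
    (continuous_bumpSlope.comp (coordEquiv m).continuous).continuousOn
  have hK0 : 0 ≤ K := (norm_nonneg _).trans (hK 0 (by simp [unitBall, totalNormSq]))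
  have hM : 0 < τ * bumpMass m := mul_pos hτ bumpMass_pos
  refine ⟨K * (m + 1) * volume.real (unitBall m) / (τ * bumpMass m), by positivity,
    fun F hF x r A hr hx hA => ?_⟩
  have hτr : |τ| < r := by rwa [abs_of_pos hτ]
  have hA0 : 0 ≤ A := (norm_nonneg _).trans (hA x (Metric.mem_closedBall_self hτ.le))
  refine ContinuousLinearMap.opNorm_le_bound _ (by positivity) fun w => ?_
  have h := congrArg norm (hF.smul_fderiv_eq hx hτr w)
  rw [norm_smul, Real.norm_of_nonneg hM.le, norm_neg,
    ← setIntegral_eq_integral_of_forall_compl_eq_zero (s := unitBall m) (fun y hy => by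
      rw [bumpSlope_eq_zero (not_le.1 hy), zero_mul, zero_smul])] at h
  have hle := norm_setIntegral_le_of_norm_le_const (μ := volume)
    (f := fun y => (bumpSlope (coordEquiv m y) * pairing (coordEquiv m y) w) •
      F (x + τ • coordEquiv m y))
    (isCompact_unitBall (m := m)).measure_lt_top (C := K * ((m + 1) * ‖w‖) * A) (fun y hy => by
      have hy1 := norm_le_of_totalNormSq_le (q := coordEquiv m y) hy
      rw [norm_smul, norm_mul]
      refine mul_le_mul (mul_le_mul (hK y hy) ?_ (norm_nonneg _) hK0) (hA _ ?_) (norm_nonneg _)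
        (by positivity)
      · refine (abs_pairing_le _ _).trans (mul_le_mul_of_nonneg_left ?_ (by positivity))
        exact mul_le_of_le_one_left (norm_nonneg _) hy1
      · rw [mem_closedBall_iff_norm, add_sub_cancel_left, norm_smul, Real.norm_of_nonneg hτ.le]
        exact mul_le_of_le_one_right hτ.le hy1)
  rw [← h] at hle
  rw [div_mul_eq_mul_div, div_mul_eq_mul_div, le_div_iff₀ hM]
  linarith

/-- Hardy functions and their derivatives are locally uniformly bounded by the Hardy norm. -/
theorem exists_local_bound {q₀ : HSpace m} (hq₀ : q₀ ∈ siegelHalfSpace m) :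
    ∃ ρ > 0, ∃ C : ℝ, 0 ≤ C ∧ ∀ F : HSpace m → ℍ[ℝ], MemHardy F → ∀ x ∈ Metric.ball q₀ ρ,
      ‖F x‖ ≤ C * hardyNorm F ∧ ‖fderiv ℝ F x‖ ≤ C * hardyNorm F := by
  have h0 := height_pos_iff.2 hq₀
  have hnhds : {q : HSpace m | height q ∈ Set.Ioo (height q₀ / 2) (2 * height q₀)} ∈ 𝓝 q₀ :=
    continuous_height.continuousAt.preimage_mem_nhds
      (Ioo_mem_nhds (by linarith) (by linarith))
  obtain ⟨R, hR, hball⟩ := Metric.mem_nhds_iff.1 hnhds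
  have hsub : Metric.ball q₀ R ⊆ siegelHalfSpace m := fun q hq =>
    height_pos_iff.1 (lt_trans (by linarith) (hball hq).1)
  -- Values are bounded on the ball of radius R/2 by averaging at scale R/4. Derivatives are bounded
  -- on radius R/4 at scale R/8, which stays where the values are controlled.
  obtain ⟨C₁, hC₁0, hC₁⟩ := exists_norm_le_hardyNorm (m := m) (τ := R / 4) (a := height q₀ / 2)
    (b := 2 * height q₀) (by linarith) (by linarith)
  obtain ⟨C₂, hC₂0, hC₂⟩ := exists_norm_fderiv_le (m := m) (τ := R / 8) (by linarith)
  have hinner : ∀ x ∈ Metric.ball q₀ (R / 2), Metric.ball x (R / 2) ⊆ siegelHalfSpace m := by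
    intro x hx
    refine (Metric.ball_subset_ball' ?_).trans hsub
    have := Metric.mem_ball.1 hx
    linarith
  have hval : ∀ F : HSpace m → ℍ[ℝ], MemHardy F → ∀ x ∈ Metric.ball q₀ (R / 2),
      ‖F x‖ ≤ C₁ * hardyNorm F := by
    intro F hF x hx
    refine hC₁ F hF x (R / 2) (by linarith) (hinner x hx) fun q hq => hball ?_
    refine Metric.closedBall_subset_ball' ?_ hq
    have := Metric.mem_ball.1 hx
    linarith
  refine ⟨R / 4, by linarith, max C₁ (C₂ * C₁), le_max_of_le_left hC₁0, fun F hF x hx => ?_⟩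
  have hn : 0 ≤ hardyNorm F := Real.sqrt_nonneg _
  have hx' : x ∈ Metric.ball q₀ (R / 2) := Metric.ball_subset_ball (by linarith) hx
  refine ⟨(hval F hF x hx').trans (mul_le_mul_of_nonneg_right (le_max_left _ _) hn), ?_⟩
  refine (hC₂ F hF.1 x (R / 2) (C₁ * hardyNorm F) (by linarith) (hinner x hx')
    fun q hq => hval F hF q ?_).trans ?_
  · refine Metric.closedBall_subset_ball' ?_ hq
    have := Metric.mem_ball.1 hx
    linarith
  · rw [← mul_assoc]
    exact mul_le_mul_of_nonneg_right (le_max_right _ _) hn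

end

noncomputable section

variable {m : ℕ} {F : HSpace m → ℍ[ℝ]}

/-! ### Closedness of the space of boundary values -/

theorem sub_eq_add_mul_neg_one (F G : HSpace m → ℍ[ℝ]) : F - G = F + fun q => G q * (-1) := by
  funext q
  simp [sub_eq_add_neg]

theorem IsRegularOn.sub {G : HSpace m → ℍ[ℝ]} (hF : IsRegularOn F (siegelHalfSpace m))
    (hG : IsRegularOn G (siegelHalfSpace m)) : IsRegularOn (F - G) (siegelHalfSpace m) := by
  rw [sub_eq_add_mul_neg_one]
  exact hF.add (hG.mul_const _)

theorem MemHardy.sub {G : HSpace m → ℍ[ℝ]} (hF : MemHardy F) (hG : MemHardy G) :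
    MemHardy (F - G) := by
  rw [sub_eq_add_mul_neg_one]
  exact hF.add (hG.mul_const _)

theorem HasBoundaryValue.sub {G : HSpace m → ℍ[ℝ]} {f g : BoundaryL2 m} (hF : MemHardy F)
    (hG : MemHardy G) (hf : HasBoundaryValue F f) (hg : HasBoundaryValue G g) :
    HasBoundaryValue (F - G) (f - g) := by
  have h := hf.add hF (hG.mul_const (-1)) (hg.mul_const hG (-1))
  rwa [← sub_eq_add_mul_neg_one, MulOpposite.op_neg, MulOpposite.op_one, neg_smul, one_smul,
    ← sub_eq_add_neg] at h

/-- A sequence of functions that is locally uniformly controlled by a Cauchy sequence converges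
locally uniformly. -/
theorem exists_tendstoLocallyUniformlyOn {X E Y : Type*} [PseudoMetricSpace X]
    [NormedAddCommGroup E] [CompleteSpace E] [PseudoMetricSpace Y] {U : Set X} {H : ℕ → X → E}
    {f : ℕ → Y} (hf : CauchySeq f)
    (hH : ∀ x₀ ∈ U, ∃ ρ > 0, ∃ C : ℝ, 0 ≤ C ∧ ∀ k l, ∀ x ∈ Metric.ball x₀ ρ,
      dist (H k x) (H l x) ≤ C * dist (f k) (f l)) :
    ∃ G : X → E, TendstoLocallyUniformlyOn H G atTop U := by
  have hunif : ∀ x₀ ∈ U, ∃ ρ > 0, UniformCauchySeqOn H atTop (Metric.ball x₀ ρ) := by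
    intro x₀ hx₀
    obtain ⟨ρ, hρ, C, hC, h⟩ := hH x₀ hx₀
    refine ⟨ρ, hρ, Metric.uniformCauchySeqOn_iff.2 fun ε hε => ?_⟩
    obtain ⟨N, hN⟩ := Metric.cauchySeq_iff.1 hf (ε / (C + 1)) (by positivity)
    refine ⟨N, fun k hk l hl x hx => (h k l x hx).trans_lt ?_⟩
    have h1 := hN k hk l hl
    rw [lt_div_iff₀ (by positivity)] at h1
    nlinarith [dist_nonneg (x := f k) (y := f l)]
  have hlim : ∀ x, ∃ y, x ∈ U → Tendsto (fun k => H k x) atTop (𝓝 y) := by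
    intro x
    by_cases hx : x ∈ U
    · obtain ⟨ρ, hρ, h⟩ := hunif x hx
      obtain ⟨y, hy⟩ := cauchySeq_tendsto_of_complete (h.cauchySeq (Metric.mem_ball_self hρ))
      exact ⟨y, fun _ => hy⟩
    · exact ⟨0, fun h => absurd h hx⟩
  choose G hG using hlim
  refine ⟨G, fun u hu x hx => ?_⟩
  obtain ⟨ρ, hρ, h⟩ := hunif x hx
  have h2 : UniformCauchySeqOn H atTop (Metric.ball x ρ ∩ U) := h.mono Set.inter_subset_left
  exact ⟨Metric.ball x ρ ∩ U, inter_mem (mem_nhdsWithin_of_mem_nhds (Metric.ball_mem_nhds x hρ))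
    self_mem_nhdsWithin, h2.tendstoUniformlyOn_of_tendsto (fun y hy => hG y hy.2) u hu⟩

/-- If a sequence of regular functions converges locally uniformly together with its derivatives, the
limit is regular. -/
theorem IsRegularOn.of_tendstoLocallyUniformlyOn {Fs : ℕ → HSpace m → ℍ[ℝ]}
    (hFs : ∀ k, IsRegularOn (Fs k) (siegelHalfSpace m))
    (hF : TendstoLocallyUniformlyOn Fs F atTop (siegelHalfSpace m))
    {F' : HSpace m → HSpace m →L[ℝ] ℍ[ℝ]}
    (hF' : TendstoLocallyUniformlyOn (fun k => fderiv ℝ (Fs k)) F' atTop (siegelHalfSpace m)) :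
    IsRegularOn F (siegelHalfSpace m) := by
  have hd : ∀ x ∈ siegelHalfSpace m, HasFDerivAt F (F' x) x := fun x hx =>
    hasFDerivAt_of_tendstoLocallyUniformlyOn isOpen_siegelHalfSpace hF'
      (fun k x hx => (hFs k).hasFDerivAt hx) (fun x hx => hF.tendsto_at hx) hx
  have hc : ContinuousOn F' (siegelHalfSpace m) :=
    hF'.continuousOn (Frequently.of_forall fun k =>
      (hFs k).1.continuousOn_fderiv_of_isOpen isOpen_siegelHalfSpace le_rfl)
  have hfd : ∀ x ∈ siegelHalfSpace m, fderiv ℝ F x = F' x := fun x hx => (hd x hx).fderiv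
  refine ⟨(contDiffOn_succ_iff_fderiv_of_isOpen (n := 0) isOpen_siegelHalfSpace).2
    ⟨fun x hx => (hd x hx).differentiableAt.differentiableWithinAt, by simp,
      contDiffOn_zero.2 (hc.congr hfd)⟩, fun q hq l => ?_⟩
  have happ : ∀ v, Tendsto (fun k => fderiv ℝ (Fs k) q v) atTop (𝓝 (fderiv ℝ F q v)) := by
    intro v
    rw [hfd q hq]
    exact ((ContinuousLinearMap.apply ℝ ℍ[ℝ] v).continuous.tendsto _).comp (hF'.tendsto_at hq)
  have h : Tendsto (fun k => cauchyFueter l (Fs k) q) atTop (𝓝 (cauchyFueter l F q)) := by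
    simp only [cauchyFueter_eq_sum_quatUnit]
    exact tendsto_finsetSum _ fun b _ => (happ _).const_mul _
  simp only [fun k => (hFs k).2 q hq l] at h
  exact (tendsto_nhds_unique h tendsto_const_nhds)

theorem isClosed_boundaryValues : IsClosed (boundaryValues m : Set (BoundaryL2 m)) := by
  refine isSeqClosed_iff_isClosed.1 fun f f₀ hf hlim => ?_
  choose Fs hFs hbv using hf
  -- The norm identity, applied to differences, makes the boundary map an isometry.
  have hnorm : ∀ k l, hardyNorm (Fs k - Fs l) = dist (f k) (f l) := fun k l => by
    rw [dist_eq_norm, ((hbv k).sub (hFs k) (hFs l) (hbv l)).norm_eq ((hFs k).sub (hFs l))]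
  have hcau := hlim.cauchySeq
  obtain ⟨F, hF⟩ := exists_tendstoLocallyUniformlyOn (U := siegelHalfSpace m) (H := Fs) hcau
    fun x₀ hx₀ => by
      obtain ⟨ρ, hρ, C, hC, h⟩ := exists_local_bound hx₀
      refine ⟨ρ, hρ, C, hC, fun k l x hx => ?_⟩
      rw [← hnorm, dist_eq_norm]
      exact (h _ ((hFs k).sub (hFs l)) x hx).1
  obtain ⟨F', hF'⟩ := exists_tendstoLocallyUniformlyOn (U := siegelHalfSpace m)
    (H := fun k => fderiv ℝ (Fs k)) hcau fun x₀ hx₀ => by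
      obtain ⟨ρ, hρ, C, hC, h⟩ := exists_local_bound hx₀
      obtain ⟨ρ', hρ', hsub⟩ := Metric.isOpen_iff.1 isOpen_siegelHalfSpace x₀ hx₀
      refine ⟨min ρ ρ', lt_min hρ hρ', C, hC, fun k l x hx => ?_⟩
      have hxU := hsub (Metric.ball_subset_ball (min_le_right _ _) hx)
      rw [← hnorm, dist_eq_norm, ← (((hFs k).1.hasFDerivAt hxU).sub
        ((hFs l).1.hasFDerivAt hxU)).fderiv]
      exact (h _ ((hFs k).sub (hFs l)) x (Metric.ball_subset_ball (min_le_left _ _) hx)).2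
  have hreg := IsRegularOn.of_tendstoLocallyUniformlyOn (fun k => (hFs k).1) hF hF'
  have hclose : ∀ ε > 0, ∃ N, ∀ k ≥ N, ∀ t > 0,
      eLpNorm (verticalTranslate (F - Fs k) t) 2 (boundaryMeasure m) ≤ ENNReal.ofReal ε := by
    intro ε hε
    obtain ⟨N, hN⟩ := Metric.cauchySeq_iff.1 hcau ε hε
    refine ⟨N, fun k hk t ht => ?_⟩
    -- Fatou on the slice at height t, as n → ∞. The slice norms of Fs n - Fs k are at most dist (f
    -- n) (f k), uniformly in t.
    have hfatou := Lp.eLpNorm_lim_le_liminf_eLpNorm (μ := boundaryMeasure m) (p := 2)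
      (f := fun n => verticalTranslate (Fs n - Fs k) t)
      (fun n => (((hFs n).sub (hFs k)).memLp ht).1) (verticalTranslate (F - Fs k) t)
      (Eventually.of_forall fun q => by
        have hmem : q.1 + Pi.single 0 (t : ℍ[ℝ]) ∈ siegelHalfSpace m := by
          have h := slicePoint_mem ht (boundaryProjection m q)
          rwa [slicePoint, Homeomorph.symm_apply_apply] at h
        exact (hF.tendsto_at hmem).sub_const _)
    refine hfatou.trans (liminf_le_of_le (by isBoundedDefault) fun b hb => ?_)
    obtain ⟨n, hbn, hn⟩ := (hb.and (eventually_ge_atTop N)).exists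
    refine hbn.trans ((eLpNorm_verticalTranslate_le _ ht).trans ?_)
    rw [((hbv n).sub (hFs n) (hFs k) (hbv k)).hardySup_eq ((hFs n).sub (hFs k)),
      ← ENNReal.rpow_natCast, ← ENNReal.rpow_mul]
    norm_num
    rw [← ofReal_norm, ← dist_eq_norm]
    exact ENNReal.ofReal_le_ofReal (hN n hn k hk).le
  have hdiff : ∀ ε > 0, ∃ N, ∀ k ≥ N, MemHardy (F - Fs k) ∧
      hardySup (F - Fs k) ≤ ENNReal.ofReal ε ^ 2 := by
    intro ε hε
    obtain ⟨N, hN⟩ := hclose ε hε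
    refine ⟨N, fun k hk => ⟨MemHardy.of_eLpNorm_le (hreg.sub (hFs k).1) ENNReal.ofReal_lt_top
      (hN k hk), iSup₂_le fun t ht => ?_⟩⟩
    rw [← eLpNorm_two_sq]
    exact pow_le_pow_left₀ zero_le (hN k hk t ht) 2
  -- F is the sum of F - Fs N and Fs N, both Hardy functions.
  have hFH : MemHardy F := by
    obtain ⟨N, hN⟩ := hdiff 1 one_pos
    simpa using (hN N le_rfl).1.add (hFs N)
  obtain ⟨f', hf'⟩ := hFH.exists_hasBoundaryValue
  -- The norm identity for F - Fs k bounds the distance from f k to the boundary value of F, so that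
  -- boundary value is the given limit.
  have hlim' : Tendsto f atTop (𝓝 f') := by
    rw [Metric.tendsto_atTop]
    intro ε hε
    obtain ⟨N, hN⟩ := hdiff (ε / 2) (by linarith)
    refine ⟨N, fun k hk => ?_⟩
    obtain ⟨hk1, hk2⟩ := hN k hk
    rw [(hf'.sub hFH (hFs k) (hbv k)).hardySup_eq hk1] at hk2
    have h := (ENNReal.pow_le_pow_left_iff two_ne_zero).1 hk2
    rw [← ofReal_norm, ENNReal.ofReal_le_ofReal_iff (by linarith), ← dist_eq_norm, dist_comm] at h
    linarith
  rw [tendsto_nhds_unique hlim hlim']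
  exact ⟨F, hFH, hf'⟩

end

end QuaternionicSiegel

theorem mainTheorem8 (m : ℕ) :
    (∀ F : QuaternionicSiegel.HSpace m → ℍ[ℝ], QuaternionicSiegel.MemHardy F →
      (∃! f : QuaternionicSiegel.BoundaryL2 m, QuaternionicSiegel.HasBoundaryValue F f) ∧
      (∀ f : QuaternionicSiegel.BoundaryL2 m, QuaternionicSiegel.HasBoundaryValue F f →
        ‖f‖ = QuaternionicSiegel.hardyNorm F)) ∧
    (∃ V : Submodule ℍ[ℝ]ᵐᵒᵖ (QuaternionicSiegel.BoundaryL2 m),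
      (V : Set (QuaternionicSiegel.BoundaryL2 m)) =
        {f | ∃ F, QuaternionicSiegel.MemHardy F ∧ QuaternionicSiegel.HasBoundaryValue F f} ∧
      IsClosed (V : Set (QuaternionicSiegel.BoundaryL2 m))) := by
  refine ⟨fun F hF => ⟨?_, fun f hf => hf.norm_eq hF⟩,
    QuaternionicSiegel.boundaryValues m, rfl, QuaternionicSiegel.isClosed_boundaryValues⟩
  obtain ⟨f, hf⟩ := hF.exists_hasBoundaryValue
  exact ⟨f, hf, fun g hg => QuaternionicSiegel.HasBoundaryValue.unique hF hg hf⟩
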